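/- Let $\mathbf k$ be a field of characteristic zero and $\mathfrak g$ a vector space over $\mathbf k$ (of any dimension). **Cochains.** For vector spaces $M,N$ and $n\ge 0$ let $C^n(M,N)=\operatorname{Hom}\big((\wedge^2M)^{\otimes n}\wedge M,N\big)$ be the space of maps $F(x_1,y_1,\dots,x_n,y_n,z)$ that are linear in each vector, skew in each pair $(x_i,y_i)$ and, if $n\ge 1$, skew in the last three vectors $x_n,y_n,z$. For $P\in C^p(M,M)$, $Q\in C^q(M,M)$ and $\mathfrak X_i=x_i\wedge y_i$ put $$\begin{aligned}(P\circ Q)(\mathfrak X_1,\dots,\mathfrak X_{p+q},z)=&\sum_{k=1}^p(-1)^{(k-1)q}\sum_{\sigma\in S(k-1,q)}(-1)^\sigma P\big(\mathfrak X_{\sigma(1)},\dots,\mathfrak X_{\sigma(k-1)},Q_\sigma(x_{k+q})\wedge y_{k+q}+x_{k+q}\wedge Q_\sigma(y_{k+q}),\mathfrak X_{k+q+1},\dots,\mathfrak X_{p+q},z\big)\\&+(-1)^{pq}\sum_{\sigma\in S(p,q)}(-1)^\sigma P\big(\mathfrak X_{\sigma(1)},\dots,\mathfrak X_{\sigma(p)},Q(\mathfrak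 X_{\sigma(p+1)},\dots,\mathfrak X_{\sigma(p+q)},z)\big),\end{aligned}$$ where $Q_\sigma(x)=Q(\mathfrak X_{\sigma(k)},\dots,\mathfrak X_{\sigma(k+q-1)},x)$ and $S(a,b)$ is the set of $(a,b)$-shuffles, and put $[P,Q]=P\circ Q-(-1)^{pq}Q\circ P$. **The spaces.** Let $\mathfrak g'$ be a copy of $\mathfrak g$, $V=\bigoplus_{n\ge0}C^n(\mathfrak g\oplus\mathfrak g',\mathfrak g\oplus\mathfrak g')$, $V_{\mathrm{Pair}}=\bigoplus_{n\ge0}C^n(\mathfrak g,\mathfrak g)$ and $\mathfrak a=\bigoplus_{n\ge0}C^n(\mathfrak g',\mathfrak g)\subset V$, with projection $\mathcal P:V\to\mathfrak a$ (restrict the inputs to $\mathfrak g'$, project the output to $\mathfrak g$). Let $V_{r\mathrm{Pair}}\subset V$ be the space of cochains that preserve parity when $\mathfrak g$ is even and $\mathfrak g'$ is odd; it is closed under the bracket. The embedding $\nu:V_{\mathrm{Pair}}\to V_{r\mathrm{Pair}}$ sends $f$ to the cochain whose value on inputs from $\mathfrak g$ or $\mathfrak g'$ is the value of $f$, placed in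 $\mathfrak g$ if the number of inputs from $\mathfrak g'$ is even and in $\mathfrak g'$ if it is odd. It satisfies $[\nu f,\nu f']\in\operatorname{im}\nu$. **The operations.** On $V_{r\mathrm{Pair}}[1]\oplus\mathfrak a$ let $$l^{m\mathrm{RB}}_2(x[1],y[1])=(-1)^{|x|}[x,y][1],\qquad l^{m\mathrm{RB}}_k(x[1],\theta_1,\dots,\theta_{k-1})=\mathcal P[\cdots[[x,\theta_1],\theta_2],\dots,\theta_{k-1}]\quad(k\ge1),$$ extended to all entries by multilinearity and graded symmetry, all other operations being zero. The operations $l^{\mathrm{ab}}_k$ on $V_{\mathrm{Pair}}[1]\oplus\mathfrak a$ are defined by the same formulas with $\nu(f)$ in place of $x$ and $\nu^{-1}[\nu(f),\nu(f')]$ in place of $[x,y]$. A Maurer–Cartan element for $\{l^{\mathrm{ab}}_k\}$ is an element $\alpha$ of degree $0$ (that is, $\alpha\in C^1(\mathfrak g,\mathfrak g)[1]\oplus C^0(\mathfrak g',\mathfrak g)$) with $\sum_{k\ge1}\frac1{k!}l^{\mathrm{ab}}_k(\alpha,\dots,\alpha)=0$, where the partial sums are eventually constant. **Theorem.** Let $\lambda\in\mathbf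 k$ be a nonzero square, $\lambda^{1/2}$ any square root of it and $\lambda^{-1/2}$ its inverse, $\pi\in\operatorname{Hom}(\wedge^3\mathfrak g,\mathfrak g)$ and $T\in\operatorname{Hom}(\mathfrak g,\mathfrak g)$. Then $(\pi[1],\lambda^{-1/2}T)$ is a Maurer–Cartan element of $(V_{\mathrm{Pair}}[1]\oplus\mathfrak a,\{l^{\mathrm{ab}}_k\}_{k\ge1})$ if and only if $\pi$ is a 3-Lie bracket, i.e. for all $x,y,u,v,w\in\mathfrak g$ $$\pi(x,y,\pi(u,v,w))=\pi(\pi(x,y,u),v,w)+\pi(u,\pi(x,y,v),w)+\pi(u,v,\pi(x,y,w)),$$ and $T$ is a modified Rota–Baxter operator of weight $\lambda$ on $(\mathfrak g,\pi)$, i.e. for all $u,v,w\in\mathfrak g$ $$\begin{aligned}\pi(Tu,Tv,Tw)=\;&T\big(\pi(Tu,Tv,w)+\pi(Tv,Tw,u)+\pi(Tw,Tu,v)+\lambda\,\pi(u,v,w)\big)\\&-\lambda\,\pi(u,v,Tw)-\lambda\,\pi(v,w,Tu)-\lambda\,\pi(w,u,Tv).\end{aligned}$$ Moreover $\{l^{\mathrm{ab}}_k\}$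 is pulled back from $\{l^{m\mathrm{RB}}_k\}$ along $\nu$: the map $\tilde\nu(f[1],\theta)=(\nu(f)[1],\theta)$ is injective and $\tilde\nu\big(l^{\mathrm{ab}}_k(\alpha_1,\dots,\alpha_k)\big)=l^{m\mathrm{RB}}_k(\tilde\nu\alpha_1,\dots,\tilde\nu\alpha_k)$ for all $k\ge1$ and all $\alpha_1,\dots,\alpha_k\in V_{\mathrm{Pair}}[1]\oplus\mathfrak a$. -/

import Mathlib

namespace ThreeLie

open Function

set_option linter.unusedSectionVars false
set_option maxSynthPendingDepth 3

noncomputable section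

/-! ### 3-Lie brackets and modified Rota-Baxter operators -/

section Basic

variable {𝕜 g : Type*} [Field 𝕜] [AddCommGroup g] [Module 𝕜 g]

/-- A skew-symmetric trilinear map `π` is a 3-Lie bracket if it satisfies the fundamental
identity. -/
def IsThreeLieBracket (π : g [⋀^Fin 3]→ₗ[𝕜] g) : Prop :=
  ∀ x y u v w : g,
    π ![x, y, π ![u, v, w]] =
      π ![π ![x, y, u], v, w] + π ![u, π ![x, y, v], w] + π ![u, v, π ![x, y, w]]

/-- The identity of a modified Rota-Baxter operator of weight `lam` on `(g, π)`
(the relative identity with both actions equal to the adjoint one). -/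
def IsModifiedRotaBaxter (lam : 𝕜) (π : g [⋀^Fin 3]→ₗ[𝕜] g) (T : g →ₗ[𝕜] g) : Prop :=
  ∀ u v w : g,
    π ![T u, T v, T w] =
      T (π ![T u, T v, w] + π ![T v, T w, u] + π ![T w, T u, v] + lam • π ![u, v, w])
        - lam • π ![u, v, T w] - lam • π ![v, w, T u] - lam • π ![w, u, T v]

end Basic

/-! ### Cochains -/

section Cochains

variable (𝕜 : Type*) [Field 𝕜]
variable {M M₁ N N₁ : Type*} [AddCommGroup M] [Module 𝕜 M] [AddCommGroup N] [Module 𝕜 N]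
  [AddCommGroup M₁] [Module 𝕜 M₁] [AddCommGroup N₁] [Module 𝕜 N₁]

/-- `F (x₁, y₁) … (xₙ, yₙ) z` is linear in each of its `2 n + 1` vectors and skew in each pair
`(xᵢ, yᵢ)`: a linear map `(⋀² M)^{⊗ n} ⊗ M → N`.  (Linearity in `yᵢ` follows from the rest.) -/
structure IsPairSkew {n : ℕ} (F : (Fin n → M × M) → M → N) : Prop where
  add_last : ∀ X z z', F X (z + z') = F X z + F X z'
  smul_last : ∀ X (c : 𝕜) z, F X (c • z) = c • F X z
  add_fst : ∀ X i x x' y z,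
    F (update X i (x + x', y)) z = F (update X i (x, y)) z + F (update X i (x', y)) z
  smul_fst : ∀ X i (c : 𝕜) x y z,
    F (update X i (c • x, y)) z = c • F (update X i (x, y)) z
  swap : ∀ X i x y z, F (update X i (y, x)) z = - F (update X i (x, y)) z

/-- Cochains of degree `n`: linear maps `(⋀² M)^{⊗ n} ∧ M → N`, that is, maps as in
`IsPairSkew` that are moreover skew in the last three vectors `xₙ, yₙ, z`. -/
structure IsCochain {n : ℕ} (F : (Fin n → M × M) → M → N) : Prop extends IsPairSkew 𝕜 F where
  swap_last : ∀ X (i : Fin n), (i : ℕ) + 1 = n → ∀ x y z,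
    F (update X i (x, z)) y = - F (update X i (x, y)) z

variable {𝕜}

namespace IsPairSkew

variable {n : ℕ} {F G : (Fin n → M × M) → M → N}

theorem add_snd (h : IsPairSkew 𝕜 F) (X : Fin n → M × M) (i x y y' z) :
    F (update X i (x, y + y')) z = F (update X i (x, y)) z + F (update X i (x, y')) z := by
  rw [h.swap, h.add_fst, h.swap X i y x, h.swap X i y' x]; abel

theorem smul_snd (h : IsPairSkew 𝕜 F) (X : Fin n → M × M) (i) (c : 𝕜) (x y z) :
    F (update X i (x, c • y)) z = c • F (update X i (x, y)) z := by
  rw [h.swap, h.smul_fst, h.swap X i y x]; simp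

theorem add (h : IsPairSkew 𝕜 F) (h' : IsPairSkew 𝕜 G) : IsPairSkew 𝕜 (F + G) where
  add_last X z z' := by simp only [Pi.add_apply, h.add_last, h'.add_last]; abel
  smul_last X c z := by simp only [Pi.add_apply, h.smul_last, h'.smul_last, smul_add]
  add_fst X i x x' y z := by simp only [Pi.add_apply, h.add_fst, h'.add_fst]; abel
  smul_fst X i c x y z := by simp only [Pi.add_apply, h.smul_fst, h'.smul_fst, smul_add]
  swap X i x y z := by simp only [Pi.add_apply, h.swap X i x y, h'.swap X i x y]; abel

theorem zero : IsPairSkew 𝕜 (0 : (Fin n → M × M) → M → N) := by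
  constructor <;> simp

theorem smul (a : 𝕜) (h : IsPairSkew 𝕜 F) : IsPairSkew 𝕜 (a • F) where
  add_last X z z' := by simp only [Pi.smul_apply, h.add_last, smul_add]
  smul_last X c z := by simp only [Pi.smul_apply, h.smul_last, smul_comm a c]
  add_fst X i x x' y z := by simp only [Pi.smul_apply, h.add_fst, smul_add]
  smul_fst X i c x y z := by simp only [Pi.smul_apply, h.smul_fst, smul_comm a c]
  swap X i x y z := by simp only [Pi.smul_apply, h.swap X i x y, smul_neg]

theorem sum {ι : Type*} (s : Finset ι) {H : ι → (Fin n → M × M) → M → N}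
    (h : ∀ i ∈ s, IsPairSkew 𝕜 (H i)) : IsPairSkew 𝕜 (∑ i ∈ s, H i) :=
  Finset.sum_induction H (IsPairSkew 𝕜) (fun _ _ => add) zero h

end IsPairSkew

variable (𝕜 M N) in
/-- The space of cochains of degree `n`. -/
def Cochain (n : ℕ) : Submodule 𝕜 ((Fin n → M × M) → M → N) where
  carrier := {F | IsCochain 𝕜 F}
  zero_mem' := ⟨IsPairSkew.zero, by simp⟩
  add_mem' := fun {F G} hF hG => ⟨hF.toIsPairSkew.add hG.toIsPairSkew, fun X i hi x y z => by
    simp only [Pi.add_apply, hF.swap_last X i hi x y, hG.swap_last X i hi x y]; abel⟩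
  smul_mem' := fun a F hF => ⟨hF.toIsPairSkew.smul a, fun X i hi x y z => by
    simp only [Pi.smul_apply, hF.swap_last X i hi x y, smul_neg]⟩

theorem comp_update {n : ℕ} (φ : M₁ →ₗ[𝕜] M) (X : Fin n → M₁ × M₁) (i : Fin n) (x y : M₁) :
    (fun j => Prod.map φ φ (update X i (x, y) j)) =
      update (fun j => Prod.map φ φ (X j)) i (φ x, φ y) := by
  ext1 j
  by_cases hj : j = i
  · subst hj; simp
  · simp [hj]

/-- `F ↦ ψ ∘ F ∘ (φ, …, φ)`. -/
def Cochain.comp (ψ : N →ₗ[𝕜] N₁) (φ : M₁ →ₗ[𝕜] M) (n : ℕ) :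
    Cochain 𝕜 M N n →ₗ[𝕜] Cochain 𝕜 M₁ N₁ n where
  toFun F := ⟨fun X z => ψ (F.1 (fun j => Prod.map φ φ (X j)) (φ z)),
    { add_last := fun X z z' => by simp [F.2.add_last]
      smul_last := fun X c z => by simp [F.2.smul_last]
      add_fst := fun X i x x' y z => by simp [comp_update, F.2.add_fst]
      smul_fst := fun X i c x y z => by simp [comp_update, F.2.smul_fst]
      swap := fun X i x y z => by simp [comp_update, F.2.swap _ i (φ x) (φ y)]
      swap_last := fun X i hi x y z => by
        simp [comp_update, F.2.swap_last _ i hi (φ x) (φ y)] }⟩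
  map_add' F G := by ext; simp
  map_smul' a F := by ext; simp

/-! ### The Rotkiewicz product and bracket -/

/-- The `(a, N - a)`-shuffles in the symmetric group on `N` letters: permutations that are
increasing on the first `a` and on the remaining positions. -/
def shuffles (a N : ℕ) : Finset (Equiv.Perm (Fin N)) :=
  Finset.univ.filter fun σ => ∀ i j : Fin N, i < j → ((j : ℕ) < a ∨ a ≤ (i : ℕ)) → σ i < σ j

/-- Which argument goes to slot `j` of the outer cochain (degree `p`) if the value of the inner
one (degree `q`) is inserted in slot `k`; slots are counted from `0`. -/
def outerSlot {p q N : ℕ} (h : p + q = N) (k : Fin p) (σ : Equiv.Perm (Fin (k + q)))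
    (j : Fin p) : Fin N :=
  if hj : j < k then
    ⟨σ ⟨j, by have := Fin.lt_def.1 hj; omega⟩,
      lt_of_lt_of_le (σ ⟨j, by have := Fin.lt_def.1 hj; omega⟩).2 (by omega)⟩
  else ⟨j + q, by omega⟩

/-- Which argument goes to slot `i` of the inner cochain. -/
def innerSlot {p q N : ℕ} (h : p + q = N) (k : Fin p) (σ : Equiv.Perm (Fin (k + q)))
    (i : Fin q) : Fin N :=
  ⟨σ ⟨k + i, by omega⟩, lt_of_lt_of_le (σ ⟨k + i, by omega⟩).2 (by omega)⟩

/-- The insertion of `Q (X ∘ e') ·`, as a derivation of `⋀² M`, into slot `k` of `P`. -/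
def insertPair {p q N : ℕ} (P : (Fin p → M × M) → M → M) (Q : (Fin q → M × M) → M → M)
    (k : Fin p) (e : Fin p → Fin N) (e' : Fin q → Fin N) : (Fin N → M × M) → M → M :=
  fun X z =>
    P (update (X ∘ e) k (Q (X ∘ e') (X (e k)).1, (X (e k)).2)) z
      + P (update (X ∘ e) k ((X (e k)).1, Q (X ∘ e') (X (e k)).2)) z

/-- The insertion of `Q (X ∘ e') ·` into the last vector of `P`. -/
def insertLast {p q N : ℕ} (P : (Fin p → M × M) → M → M) (Q : (Fin q → M × M) → M → M)
    (e : Fin p → Fin N) (e' : Fin q → Fin N) : (Fin N → M × M) → M → M :=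
  fun X z => P (X ∘ e) (Q (X ∘ e') z)

/-- The product `P ∘ Q` of cochains of degrees `p` and `q`, of degree `p + q = N`. -/
def circ {p q N : ℕ} (h : p + q = N) (P : (Fin p → M × M) → M → M)
    (Q : (Fin q → M × M) → M → M) : (Fin N → M × M) → M → M :=
  (∑ k : Fin p, ∑ σ ∈ shuffles k (k + q), ((-1) ^ ((k : ℕ) * q) * (Equiv.Perm.sign σ : ℤ)) •
      insertPair P Q k (outerSlot h k σ) (innerSlot h k σ))
  + ∑ σ ∈ shuffles p N, ((-1) ^ (p * q) * (Equiv.Perm.sign σ : ℤ)) •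
      insertLast P Q (fun j => σ ⟨j, by omega⟩) (fun i => σ ⟨p + i, by omega⟩)

theorem update_comp_right {α : Type*} {p N : ℕ} {e : Fin p → Fin N} (he : Injective e)
    (X : Fin N → α) (j : Fin p) (a : α) : update X (e j) a ∘ e = update (X ∘ e) j a :=
  update_comp_eq_of_injective X he j a

theorem update_comp_right' {α : Type*} {p N : ℕ} {e : Fin p → Fin N} {i : Fin N}
    (he : ∀ j, e j ≠ i) (X : Fin N → α) (a : α) : update X i a ∘ e = X ∘ e := by
  funext j; simp [he j]

section insertions

variable {p q N : ℕ} {P : (Fin p → M × M) → M → M} {Q : (Fin q → M × M) → M → M}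
  {e : Fin p → Fin N} {e' : Fin q → Fin N}

theorem isPairSkew_insertLast (hP : IsPairSkew 𝕜 P) (hQ : IsPairSkew 𝕜 Q)
    (he : Injective e) (he' : Injective e') (hd : ∀ j i, e j ≠ e' i)
    (hc : ∀ i, (∃ j, e j = i) ∨ ∃ j, e' j = i) : IsPairSkew 𝕜 (insertLast P Q e e') where
  add_last X z z' := by simp [insertLast, hQ.add_last, hP.add_last]
  smul_last X c z := by simp [insertLast, hQ.smul_last, hP.smul_last]
  add_fst X i x x' y z := by
    rcases hc i with ⟨j, rfl⟩ | ⟨j, rfl⟩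
    · simp [insertLast, update_comp_right he, update_comp_right' (fun i => (hd j i).symm),
        hP.add_fst]
    · simp [insertLast, update_comp_right he', update_comp_right' (fun i => hd i j),
        hQ.add_fst, hP.add_last]
  smul_fst X i c x y z := by
    rcases hc i with ⟨j, rfl⟩ | ⟨j, rfl⟩
    · simp [insertLast, update_comp_right he, update_comp_right' (fun i => (hd j i).symm),
        hP.smul_fst]
    · simp [insertLast, update_comp_right he', update_comp_right' (fun i => hd i j),
        hQ.smul_fst, hP.smul_last]
  swap X i x y z := by
    rcases hc i with ⟨j, rfl⟩ | ⟨j, rfl⟩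
    · simp [insertLast, update_comp_right he, update_comp_right' (fun i => (hd j i).symm),
        hP.swap _ j x y]
    · have := hP.smul_last (X ∘ e) (-1 : 𝕜) (Q (update (X ∘ e') j (x, y)) z)
      simp only [neg_smul, one_smul] at this
      simp [insertLast, update_comp_right he', update_comp_right' (fun i => hd i j),
        hQ.swap _ j x y, this]

theorem isPairSkew_insertPair (hP : IsPairSkew 𝕜 P) (hQ : IsPairSkew 𝕜 Q) (k : Fin p)
    (he : Injective e) (he' : Injective e') (hd : ∀ j i, e j ≠ e' i)
    (hc : ∀ i, (∃ j, e j = i) ∨ ∃ j, e' j = i) : IsPairSkew 𝕜 (insertPair P Q k e e') where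
  add_last X z z' := by simp only [insertPair, hP.add_last]; abel
  smul_last X c z := by simp only [insertPair, hP.smul_last, smul_add]
  add_fst X i x x' y z := by
    rcases hc i with ⟨j, rfl⟩ | ⟨j, rfl⟩
    · by_cases hj : j = k
      · subst hj
        simp only [insertPair, update_comp_right he, update_comp_right' (fun i => (hd j i).symm),
          update_self, update_idem, hQ.add_last, hP.add_fst]
        abel
      · have hk : e k ≠ e j := fun h => hj (he h).symm
        simp only [insertPair, update_comp_right he, update_comp_right' (fun i => (hd j i).symm),
          update_of_ne hk, update_comm hj, hP.add_fst]
        abel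
    · simp only [insertPair, update_comp_right he', update_comp_right' (fun i => hd i j),
        update_of_ne (hd k j), hQ.add_fst, hP.add_fst, hP.add_snd]
      abel
  smul_fst X i c x y z := by
    rcases hc i with ⟨j, rfl⟩ | ⟨j, rfl⟩
    · by_cases hj : j = k
      · subst hj
        simp only [insertPair, update_comp_right he, update_comp_right' (fun i => (hd j i).symm),
          update_self, update_idem, hQ.smul_last, hP.smul_fst, smul_add]
      · have hk : e k ≠ e j := fun h => hj (he h).symm
        simp only [insertPair, update_comp_right he, update_comp_right' (fun i => (hd j i).symm),
          update_of_ne hk, update_comm hj, hP.smul_fst, smul_add]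
    · simp only [insertPair, update_comp_right he', update_comp_right' (fun i => hd i j),
        update_of_ne (hd k j), hQ.smul_fst, hP.smul_fst, hP.smul_snd, smul_add]
  swap X i x y z := by
    rcases hc i with ⟨j, rfl⟩ | ⟨j, rfl⟩
    · by_cases hj : j = k
      · subst hj
        simp only [insertPair, update_comp_right he, update_comp_right' (fun i => (hd j i).symm),
          update_self, update_idem]
        rw [hP.swap _ j x, hP.swap _ j _ y]
        abel
      · have hk : e k ≠ e j := fun h => hj (he h).symm
        simp only [insertPair, update_comp_right he, update_comp_right' (fun i => (hd j i).symm),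
          update_of_ne hk, update_comm hj, hP.swap _ j x y]
        abel
    · simp only [insertPair, update_comp_right he', update_comp_right' (fun i => hd i j),
        update_of_ne (hd k j), hQ.swap _ j x y]
      rw [← neg_one_smul 𝕜, hP.smul_fst, ← neg_one_smul 𝕜 (Q _ (X (e k)).2), hP.smul_snd]
      simp only [neg_smul, one_smul]
      abel

end insertions

section slots

variable {p q N : ℕ} (h : p + q = N)

theorem outerSlot_val_lt {k j : Fin p} (σ : Equiv.Perm (Fin (k + q))) (hj : j < k) :
    (outerSlot h k σ j : ℕ) = σ ⟨j, by have := Fin.lt_def.1 hj; omega⟩ := by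
  simp [outerSlot, hj]

theorem outerSlot_val_ge {k j : Fin p} (σ : Equiv.Perm (Fin (k + q))) (hj : ¬ j < k) :
    (outerSlot h k σ j : ℕ) = j + q := by
  simp [outerSlot, hj]

theorem outerSlot_injective (k : Fin p) (σ : Equiv.Perm (Fin (k + q))) :
    Injective (outerSlot h k σ) := by
  intro i j hij
  have hv := congrArg Fin.val hij
  by_cases hi : i < k <;> by_cases hj : j < k
  · rw [outerSlot_val_lt h σ hi, outerSlot_val_lt h σ hj] at hv
    have := σ.injective (Fin.ext hv)
    exact Fin.ext (by simpa using this)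
  · rw [outerSlot_val_lt h σ hi, outerSlot_val_ge h σ hj] at hv
    have := (σ ⟨i, by have := Fin.lt_def.1 hi; omega⟩).2
    have := Fin.lt_def.not.1 hj
    omega
  · rw [outerSlot_val_ge h σ hi, outerSlot_val_lt h σ hj] at hv
    have := (σ ⟨j, by have := Fin.lt_def.1 hj; omega⟩).2
    have := Fin.lt_def.not.1 hi
    omega
  · rw [outerSlot_val_ge h σ hi, outerSlot_val_ge h σ hj] at hv
    exact Fin.ext (by omega)

theorem innerSlot_injective (k : Fin p) (σ : Equiv.Perm (Fin (k + q))) :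
    Injective (innerSlot h k σ) := by
  intro i j hij
  have hv := congrArg Fin.val hij
  have := σ.injective (Fin.ext hv)
  exact Fin.ext (by simpa using this)

theorem outerSlot_ne_innerSlot (k : Fin p) (σ : Equiv.Perm (Fin (k + q))) (j : Fin p)
    (i : Fin q) : outerSlot h k σ j ≠ innerSlot h k σ i := by
  intro hij
  have hv := congrArg Fin.val hij
  by_cases hj : j < k
  · rw [outerSlot_val_lt h σ hj] at hv
    have := σ.injective (Fin.ext hv)
    have := congrArg Fin.val this
    have := Fin.lt_def.1 hj
    simp at *
    omega
  · rw [outerSlot_val_ge h σ hj] at hv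
    have := (σ ⟨k + i, by omega⟩).2
    have := Fin.lt_def.not.1 hj
    simp only [innerSlot] at hv
    omega

theorem slot_cover (k : Fin p) (σ : Equiv.Perm (Fin (k + q))) (i : Fin N) :
    (∃ j, outerSlot h k σ j = i) ∨ ∃ j, innerSlot h k σ j = i := by
  by_cases hi : (i : ℕ) < k + q
  · obtain ⟨m, hm⟩ := σ.surjective ⟨i, hi⟩
    by_cases hmk : (m : ℕ) < k
    · left
      refine ⟨⟨m, by omega⟩, Fin.ext ?_⟩
      rw [outerSlot_val_lt h σ (Fin.lt_def.2 hmk)]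
      simp [hm]
    · right
      refine ⟨⟨m - k, by omega⟩, Fin.ext ?_⟩
      have : (⟨k + (m - k), by omega⟩ : Fin (k + q)) = m := Fin.ext (by simp; omega)
      simp [innerSlot, this, hm]
  · left
    refine ⟨⟨i - q, by omega⟩, Fin.ext ?_⟩
    rw [outerSlot_val_ge h σ (by simp [Fin.lt_def]; omega)]
    simp; omega

end slots

theorem isPairSkew_zsmul {n : ℕ} (a : ℤ) {F : (Fin n → M × M) → M → N} (h : IsPairSkew 𝕜 F) :
    IsPairSkew 𝕜 (a • F) := by
  have : a • F = (a : 𝕜) • F := (Int.cast_smul_eq_zsmul 𝕜 a F).symm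
  rw [this]; exact h.smul _

theorem isPairSkew_circ {p q N : ℕ} (h : p + q = N) {P : (Fin p → M × M) → M → M}
    {Q : (Fin q → M × M) → M → M} (hP : IsPairSkew 𝕜 P) (hQ : IsPairSkew 𝕜 Q) :
    IsPairSkew 𝕜 (circ h P Q) := by
  refine IsPairSkew.add (IsPairSkew.sum _ fun k _ => IsPairSkew.sum _ fun σ _ =>
    isPairSkew_zsmul _ ?_) (IsPairSkew.sum _ fun σ _ => isPairSkew_zsmul _ ?_)
  · exact isPairSkew_insertPair hP hQ k (outerSlot_injective h k σ) (innerSlot_injective h k σ)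
      (outerSlot_ne_innerSlot h k σ) (slot_cover h k σ)
  · refine isPairSkew_insertLast hP hQ ?_ ?_ ?_ ?_
    · intro i j hij
      have := σ.injective hij
      exact Fin.ext (by simpa using this)
    · intro i j hij
      have := σ.injective hij
      exact Fin.ext (by simpa using this)
    · intro j i hij
      have := congrArg Fin.val (σ.injective hij)
      simp at this
      omega
    · intro i
      obtain ⟨m, rfl⟩ := σ.surjective i
      by_cases hm : (m : ℕ) < p
      · exact Or.inl ⟨⟨m, hm⟩, rfl⟩
      · refine Or.inr ⟨⟨m - p, by omega⟩, congrArg σ (Fin.ext ?_)⟩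
        simp; omega

/-! #### Skew-symmetry of the product in the last three vectors -/

/-- Extend a permutation of `n` letters by `i ↦ n`. -/
def extendPerm {n : ℕ} (i : Fin (n + 1)) (τ : Equiv.Perm (Fin n)) : Equiv.Perm (Fin (n + 1)) :=
  τ.extendDomain (finSuccAboveEquiv (Fin.last n)) * (Fin.cycleIcc i (Fin.last n))⁻¹

theorem extendPerm_self {n : ℕ} (i : Fin (n + 1)) (τ : Equiv.Perm (Fin n)) :
    extendPerm i τ i = Fin.last n := by
  have h : (Fin.cycleIcc i (Fin.last n))⁻¹ i = Fin.last n := by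
    rw [Equiv.Perm.inv_eq_iff_eq, Fin.cycleIcc_of_last (Fin.le_last i)]
  rw [extendPerm, Equiv.Perm.mul_apply, h, Equiv.Perm.extendDomain_apply_not_subtype _ _ (by simp)]

theorem extendPerm_succAbove {n : ℕ} (i : Fin (n + 1)) (τ : Equiv.Perm (Fin n)) (m : Fin n) :
    extendPerm i τ (i.succAbove m) = (τ m).castSucc := by
  have h : (Fin.cycleIcc i (Fin.last n))⁻¹ (i.succAbove m) = m.castSucc := by
    rw [Equiv.Perm.inv_eq_iff_eq]
    have := congrFun (Fin.cycleIcc_comp_succAbove i (Fin.last n) (Fin.le_last i)) m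
    simpa using this.symm
  have h' := Equiv.Perm.extendDomain_apply_image τ (finSuccAboveEquiv (Fin.last n)) m
  simp only [finSuccAboveEquiv_apply, Fin.succAbove_last] at h'
  rw [extendPerm, Equiv.Perm.mul_apply, h, h']

theorem sign_extendPerm {n : ℕ} (i : Fin (n + 1)) (τ : Equiv.Perm (Fin n)) :
    Equiv.Perm.sign (extendPerm i τ) = (-1) ^ (n - (i : ℕ)) * Equiv.Perm.sign τ := by
  rw [extendPerm, map_mul, Equiv.Perm.sign_extendDomain, Equiv.Perm.sign_inv,
    Fin.sign_cycleIcc_of_le (Fin.le_last i), mul_comm]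
  simp

theorem exists_extendPerm {n : ℕ} (i : Fin (n + 1)) (σ : Equiv.Perm (Fin (n + 1)))
    (h : σ i = Fin.last n) : ∃ τ, σ = extendPerm i τ := by
  have hne : ∀ m, σ (i.succAbove m) ≠ Fin.last n := fun m hm =>
    Fin.succAbove_ne i m (σ.injective (hm.trans h.symm))
  let f : Fin n → Fin n := fun m => (σ (i.succAbove m)).castPred (hne m)
  have hf : Injective f := fun a b hab => by
    have := Fin.castPred_inj.1 hab
    exact Fin.succAbove_right_injective (σ.injective this)
  refine ⟨Equiv.ofBijective f (Finite.injective_iff_bijective.1 hf), ?_⟩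
  ext1 j
  rcases Fin.eq_self_or_eq_succAbove i j with rfl | ⟨m, rfl⟩
  · rw [h, extendPerm_self]
  · rw [extendPerm_succAbove]; simp [f]

theorem extendPerm_injective {n : ℕ} (i : Fin (n + 1)) : Injective (extendPerm i) := by
  intro a b hab
  ext1 m
  have := congrArg (fun σ => σ (i.succAbove m)) hab
  simpa [extendPerm_succAbove] using this

theorem mem_shuffles {a N : ℕ} {σ : Equiv.Perm (Fin N)} : σ ∈ shuffles a N ↔
    ∀ i j : Fin N, i < j → ((j : ℕ) < a ∨ a ≤ (i : ℕ)) → σ i < σ j := by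
  simp [shuffles]

theorem succAbove_val {n : ℕ} (i : Fin (n + 1)) (m : Fin n) :
    (i.succAbove m : ℕ) = if (m : ℕ) < i then (m : ℕ) else m + 1 := by
  split_ifs with h
  · rw [Fin.succAbove_of_castSucc_lt _ _ (by simpa [Fin.lt_def] using h)]; simp
  · rw [Fin.succAbove_of_le_castSucc _ _ (by simpa [Fin.le_def] using not_lt.1 h)]; simp

theorem extendPerm_mem_shuffles {n a : ℕ} (i : Fin (n + 1)) (hi : (i : ℕ) = a)
    (τ : Equiv.Perm (Fin n)) : extendPerm i τ ∈ shuffles (a + 1) (n + 1) ↔ τ ∈ shuffles a n := by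
  rw [mem_shuffles, mem_shuffles]
  constructor
  · intro H b c hbc hor
    have := H (i.succAbove b) (i.succAbove c) (Fin.succAbove_lt_succAbove_iff.2 hbc) (by
      rw [succAbove_val, succAbove_val]; split_ifs <;> omega)
    rwa [extendPerm_succAbove, extendPerm_succAbove, Fin.castSucc_lt_castSucc_iff] at this
  · intro H b c hbc hor
    rcases Fin.eq_self_or_eq_succAbove i b with rfl | ⟨b, rfl⟩
    · have := Fin.lt_def.1 hbc
      omega
    · rcases Fin.eq_self_or_eq_succAbove i c with rfl | ⟨c, rfl⟩
      · rw [extendPerm_self, extendPerm_succAbove]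
        exact Fin.castSucc_lt_last _
      · rw [extendPerm_succAbove, extendPerm_succAbove, Fin.castSucc_lt_castSucc_iff]
        refine H b c (Fin.succAbove_lt_succAbove_iff.1 hbc) ?_
        rw [succAbove_val, succAbove_val] at hor
        have := Fin.lt_def.1 (Fin.succAbove_lt_succAbove_iff.1 hbc)
        split_ifs at hor <;> omega

/-- The failure of skew-symmetry in the last two of the vectors `xᵢ, yᵢ, z`. -/
def skewDefect {n : ℕ} (i : Fin n) (X : Fin n → M × M) (x y z : M)
    (F : (Fin n → M × M) → M → N) : N :=
  F (update X i (x, z)) y + F (update X i (x, y)) z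

theorem skewDefect_zsmul {n : ℕ} (i : Fin n) (X : Fin n → M × M) (x y z : M) (a : ℤ)
    (F : (Fin n → M × M) → M → N) : skewDefect i X x y z (a • F) = a • skewDefect i X x y z F := by
  simp [skewDefect]

theorem skewDefect_add {n : ℕ} (i : Fin n) (X : Fin n → M × M) (x y z : M)
    (F G : (Fin n → M × M) → M → N) :
    skewDefect i X x y z (F + G) = skewDefect i X x y z F + skewDefect i X x y z G := by
  simp only [skewDefect, Pi.add_apply]; abel

theorem skewDefect_sum {ι : Type*} {n : ℕ} (i : Fin n) (X : Fin n → M × M) (x y z : M)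
    (s : Finset ι) (F : ι → (Fin n → M × M) → M → N) :
    skewDefect i X x y z (∑ a ∈ s, F a) = ∑ a ∈ s, skewDefect i X x y z (F a) := by
  simp [skewDefect, Finset.sum_apply, Finset.sum_add_distrib]

section defect

variable {p q N : ℕ} {P : (Fin p → M × M) → M → M} {Q : (Fin q → M × M) → M → M}
  {e : Fin p → Fin N} {e' : Fin q → Fin N}

theorem skewDefect_insertLast_inner (hP : IsPairSkew 𝕜 P) (hQ : IsCochain 𝕜 Q)
    (he' : Injective e') (j : Fin q) (hj : (j : ℕ) + 1 = q) (hd : ∀ i, e i ≠ e' j)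
    (X : Fin N → M × M) (x y z : M) : skewDefect (e' j) X x y z (insertLast P Q e e') = 0 := by
  simp only [skewDefect, insertLast, update_comp_right he', update_comp_right' hd]
  rw [← hP.add_last, hQ.swap_last _ j hj x y z, neg_add_cancel]
  simpa using hP.smul_last (X ∘ e) (0 : 𝕜) 0

theorem skewDefect_insertLast_outer (hP : IsCochain 𝕜 P)
    (he : Injective e) (j : Fin p) (hj : (j : ℕ) + 1 = p) (hd : ∀ i, e' i ≠ e j)
    (X : Fin N → M × M) (x y z : M) : skewDefect (e j) X x y z (insertLast P Q e e') =
      - (P (update (X ∘ e) j (x, Q (X ∘ e') y)) z + P (update (X ∘ e) j (x, Q (X ∘ e') z)) y) := by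
  simp only [skewDefect, insertLast, update_comp_right he, update_comp_right' hd]
  rw [hP.swap_last _ j hj x (Q (X ∘ e') y) z, hP.swap_last _ j hj x (Q (X ∘ e') z) y]
  abel

theorem skewDefect_insertPair_of_ne (hP : IsCochain 𝕜 P)
    (he : Injective e) (k j : Fin p) (hkj : k ≠ j) (hj : (j : ℕ) + 1 = p)
    (hd : ∀ i, e' i ≠ e j) (X : Fin N → M × M) (x y z : M) :
    skewDefect (e j) X x y z (insertPair P Q k e e') = 0 := by
  have hk : e k ≠ e j := fun h => hkj (he h)
  simp only [skewDefect, insertPair, update_comp_right he, update_comp_right' hd,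
    update_of_ne hk, update_comm hkj.symm]
  rw [hP.swap_last _ j hj x y z, hP.swap_last _ j hj x y z]
  abel

theorem skewDefect_insertPair_self (hP : IsCochain 𝕜 P)
    (he : Injective e) (j : Fin p) (hj : (j : ℕ) + 1 = p)
    (hd : ∀ i, e' i ≠ e j) (X : Fin N → M × M) (x y z : M) :
    skewDefect (e j) X x y z (insertPair P Q j e e') =
      P (update (X ∘ e) j (x, Q (X ∘ e') y)) z + P (update (X ∘ e) j (x, Q (X ∘ e') z)) y := by
  simp only [skewDefect, insertPair, update_comp_right he, update_comp_right' hd,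
    update_self, update_idem]
  rw [hP.swap_last _ j hj (Q (X ∘ e') x) y z]
  abel

end defect

theorem isCochain_circ {p q N : ℕ} (h : p + q = N) {P : (Fin p → M × M) → M → M}
    {Q : (Fin q → M × M) → M → M} (hP : IsCochain 𝕜 P) (hQ : IsCochain 𝕜 Q) :
    IsCochain 𝕜 (circ h P Q) := by
  refine ⟨isPairSkew_circ h hP.toIsPairSkew hQ.toIsPairSkew, fun X i hi x y z => ?_⟩
  refine eq_neg_of_add_eq_zero_left (?_ : skewDefect i X x y z (circ h P Q) = 0)
  rw [circ, skewDefect_add, skewDefect_sum, skewDefect_sum]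
  simp only [skewDefect_sum, skewDefect_zsmul]
  -- the terms in which the inner cochain takes the last pair
  have inner0 : ∀ σ ∈ shuffles p N, (∀ j : Fin p, σ ⟨j, by omega⟩ ≠ i) →
      skewDefect i X x y z (insertLast P Q (fun j => σ ⟨j, by omega⟩)
        (fun i => σ ⟨p + i, by omega⟩)) = 0 := by
    intro σ hσ hne
    have hq : 0 < q := by
      by_contra hq0
      obtain ⟨m, hm⟩ := σ.surjective i
      exact hne ⟨m, by omega⟩ hm
    have hlast : σ ⟨p + (q - 1), by omega⟩ = i := by
      obtain ⟨m, hm⟩ := σ.surjective i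
      have hmp : p ≤ (m : ℕ) := by
        by_contra hlt
        exact hne ⟨m, by omega⟩ hm
      by_cases hml : (m : ℕ) = p + (q - 1)
      · rw [← hm]; congr 1; exact Fin.ext hml.symm
      · have := mem_shuffles.1 hσ m ⟨p + (q - 1), by omega⟩ (by rw [Fin.lt_def]; simp; omega)
          (Or.inr hmp)
        rw [hm, Fin.lt_def] at this
        omega
    have := skewDefect_insertLast_inner (P := P) (Q := Q) (e := fun j : Fin p => σ ⟨j, by omega⟩)
      (e' := fun i : Fin q => σ ⟨p + i, by omega⟩) hP.toIsPairSkew hQ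
      (fun a b hab => by simpa [Fin.ext_iff] using σ.injective hab) ⟨q - 1, by omega⟩
      (by simp; omega) (fun a ha => by
        have := congrArg Fin.val (σ.injective ha); simp at this; omega) X x y z
    simpa only [hlast] using this
  cases p with
  | zero =>
    rw [Finset.univ_eq_empty, Finset.sum_empty, zero_add]
    refine Finset.sum_eq_zero fun σ hσ => ?_
    rw [inner0 σ hσ (fun j => j.elim0), smul_zero]
  | succ a =>
    obtain rfl : N = a + q + 1 := by omega
    obtain rfl : i = Fin.last (a + q) := Fin.ext (by simpa using hi)
    have hout : ∀ (k : Fin (a + 1)) (σ : Equiv.Perm (Fin (k + q))),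
        outerSlot h k σ (Fin.last a) = Fin.last (a + q) := fun k σ =>
      Fin.ext (by rw [outerSlot_val_ge h σ (not_lt.2 (Fin.le_last k))]; simp)
    rw [Fin.sum_univ_castSucc, Finset.sum_eq_zero (s := Finset.univ), zero_add]
    · set i₀ : Fin (a + q + 1) := ⟨a, by omega⟩ with hi₀
      rw [← Finset.sum_of_injOn (extendPerm i₀) (s := shuffles a (a + q))
        (f := fun τ => ((-1) ^ ((a + 1) * q) * ((Equiv.Perm.sign (extendPerm i₀ τ) : ℤˣ) : ℤ)) •
          skewDefect (Fin.last (a + q)) X x y z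
            (insertLast P Q (fun j => extendPerm i₀ τ ⟨j, by omega⟩)
              (fun i => extendPerm i₀ τ ⟨a + 1 + i, by omega⟩)))
        ((extendPerm_injective i₀).injOn)
        (fun τ hτ => (extendPerm_mem_shuffles i₀ rfl τ).2 hτ) ?_ (fun _ _ => rfl),
        show shuffles (Fin.last a : ℕ) ((Fin.last a : ℕ) + q) = shuffles a (a + q) from rfl]
      · refine (Finset.sum_add_distrib (s := shuffles a (a + q))).symm.trans ?_
        refine Finset.sum_eq_zero fun τ _ => ?_
        have hs : ∀ j : Fin a, (⟨j, by omega⟩ : Fin (a + q + 1)) =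
            i₀.succAbove ⟨j, by omega⟩ := fun j => Fin.ext (by
          rw [succAbove_val]; simp [hi₀])
        have hs' : ∀ j : Fin q, (⟨a + 1 + j, by omega⟩ : Fin (a + q + 1)) =
            i₀.succAbove ⟨a + j, by omega⟩ := fun j => Fin.ext (by
          rw [succAbove_val]; simp [hi₀]; omega)
        have e1 : (fun j : Fin (a + 1) => extendPerm i₀ τ ⟨j, by omega⟩) =
            outerSlot h (Fin.last a) τ := by
          funext j
          refine Fin.lastCases ?_ (fun j => ?_) j
          · rw [hout]; exact extendPerm_self i₀ τ
          · apply Fin.ext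
            rw [outerSlot_val_lt h τ (Fin.castSucc_lt_last j)]
            have := hs j
            simp only [Fin.val_castSucc]
            rw [this, extendPerm_succAbove]
            rfl
        have e2 : (fun j : Fin q => extendPerm i₀ τ ⟨a + 1 + j, by omega⟩) =
            innerSlot h (Fin.last a) τ := by
          funext j
          rw [hs' j, extendPerm_succAbove]
          rfl
        have A := skewDefect_insertPair_self (Q := Q) hP
          (outerSlot_injective h (Fin.last a) τ) (Fin.last a) (by simp)
          (fun i => (outerSlot_ne_innerSlot h (Fin.last a) τ (Fin.last a) i).symm) X x y z
        have B := skewDefect_insertLast_outer (Q := Q) hP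
          (outerSlot_injective h (Fin.last a) τ) (Fin.last a) (by simp)
          (fun i => (outerSlot_ne_innerSlot h (Fin.last a) τ (Fin.last a) i).symm) X x y z
        rw [hout] at A B
        rw [e1, e2, A, B, sign_extendPerm, smul_neg, ← sub_eq_add_neg, ← sub_smul]
        have : a + q - (i₀ : ℕ) = q := by simp [hi₀]
        rw [this]
        have hsq : ((-1 : ℤ) ^ q) * (-1) ^ q = 1 := by rw [← mul_pow]; simp
        have : ((-1 : ℤ) ^ ((Fin.last a : ℕ) * q) * ((Equiv.Perm.sign τ : ℤˣ) : ℤ) -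
            (-1) ^ ((a + 1) * q) * (((-1) ^ q * Equiv.Perm.sign τ : ℤˣ) : ℤ)) = 0 := by
          push_cast
          rw [add_mul, pow_add, one_mul]
          linear_combination (-(-1 : ℤ) ^ (a * q) * ((Equiv.Perm.sign τ : ℤˣ) : ℤ)) * hsq
        exact (congrArg (· • _) this).trans (zero_smul ℤ _)
      · intro σ hσ hnot
        rw [inner0 σ hσ, smul_zero]
        intro j hj
        have hja : (j : ℕ) = a := by
          by_contra hne
          have := mem_shuffles.1 hσ ⟨j, by omega⟩ i₀ (by rw [Fin.lt_def]; simp [hi₀]; omega)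
            (Or.inl (by simp [hi₀]))
          rw [hj] at this
          exact absurd this (not_lt.2 (Fin.le_last _))
        have hji : (⟨j, by omega⟩ : Fin (a + q + 1)) = i₀ := Fin.ext hja
        rw [hji] at hj
        obtain ⟨τ, rfl⟩ := exists_extendPerm i₀ σ hj
        exact hnot ⟨τ, (extendPerm_mem_shuffles i₀ rfl τ).1 hσ, rfl⟩
    · intro k _
      refine Finset.sum_eq_zero fun σ _ => ?_
      have := skewDefect_insertPair_of_ne (Q := Q) hP
          (outerSlot_injective h k.castSucc σ) k.castSucc (Fin.last a)
          (Fin.castSucc_lt_last k).ne (by simp)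
          (fun i => (outerSlot_ne_innerSlot h k.castSucc σ (Fin.last a) i).symm) X x y z
      rw [hout] at this
      rw [this, smul_zero]

/-! #### The product and the graded commutator as bilinear maps -/

section bilinear

variable {p q N : ℕ} (k : Fin p) (e : Fin p → Fin N) (e' : Fin q → Fin N)

theorem circ_add_left (h : p + q = N) (P P' : (Fin p → M × M) → M → M)
    (Q : (Fin q → M × M) → M → M) : circ h (P + P') Q = circ h P Q + circ h P' Q := by
  have h1 : ∀ (k : Fin p) (e : Fin p → Fin N) (e' : Fin q → Fin N),
      insertPair (P + P') Q k e e' = insertPair P Q k e e' + insertPair P' Q k e e' := by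
    intro k e e'; funext X z; simp only [insertPair, Pi.add_apply]; abel
  have h2 : ∀ (e : Fin p → Fin N) (e' : Fin q → Fin N),
      insertLast (P + P') Q e e' = insertLast P Q e e' + insertLast P' Q e e' := by
    intro e e'; funext X z; simp only [insertLast, Pi.add_apply]
  simp only [circ, h1, h2, smul_add, Finset.sum_add_distrib]
  abel

theorem circ_smul_left (h : p + q = N) (a : 𝕜) (P : (Fin p → M × M) → M → M)
    (Q : (Fin q → M × M) → M → M) : circ h (a • P) Q = a • circ h P Q := by
  have h1 : ∀ (k : Fin p) (e : Fin p → Fin N) (e' : Fin q → Fin N),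
      insertPair (a • P) Q k e e' = a • insertPair P Q k e e' := by
    intro k e e'; funext X z; simp only [insertPair, Pi.smul_apply, smul_add]
  have h2 : ∀ (e : Fin p → Fin N) (e' : Fin q → Fin N),
      insertLast (a • P) Q e e' = a • insertLast P Q e e' := by
    intro e e'; funext X z; simp only [insertLast, Pi.smul_apply]
  simp only [circ, h1, h2, smul_add, Finset.smul_sum, smul_comm a]

theorem circ_add_right (h : p + q = N) {P : (Fin p → M × M) → M → M} (hP : IsPairSkew 𝕜 P)
    (Q Q' : (Fin q → M × M) → M → M) : circ h P (Q + Q') = circ h P Q + circ h P Q' := by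
  have h1 : ∀ (k : Fin p) (e : Fin p → Fin N) (e' : Fin q → Fin N),
      insertPair P (Q + Q') k e e' = insertPair P Q k e e' + insertPair P Q' k e e' := by
    intro k e e'; funext X z
    simp only [insertPair, Pi.add_apply, hP.add_fst, hP.add_snd]; abel
  have h2 : ∀ (e : Fin p → Fin N) (e' : Fin q → Fin N),
      insertLast P (Q + Q') e e' = insertLast P Q e e' + insertLast P Q' e e' := by
    intro e e'; funext X z; simp only [insertLast, Pi.add_apply, hP.add_last]
  simp only [circ, h1, h2, smul_add, Finset.sum_add_distrib]
  abel

theorem circ_smul_right (h : p + q = N) (a : 𝕜) {P : (Fin p → M × M) → M → M}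
    (hP : IsPairSkew 𝕜 P) (Q : (Fin q → M × M) → M → M) :
    circ h P (a • Q) = a • circ h P Q := by
  have h1 : ∀ (k : Fin p) (e : Fin p → Fin N) (e' : Fin q → Fin N),
      insertPair P (a • Q) k e e' = a • insertPair P Q k e e' := by
    intro k e e'; funext X z
    simp only [insertPair, Pi.smul_apply, smul_add, hP.smul_fst, hP.smul_snd]
  have h2 : ∀ (e : Fin p → Fin N) (e' : Fin q → Fin N),
      insertLast P (a • Q) e e' = a • insertLast P Q e e' := by
    intro e e'; funext X z; simp only [insertLast, Pi.smul_apply, hP.smul_last]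
  simp only [circ, h1, h2, smul_add, Finset.smul_sum, smul_comm a]

/-- The product is compatible with linear maps that intertwine the cochains. -/
theorem circ_natural (h : p + q = N) (φ : M →ₗ[𝕜] M₁) {P : (Fin p → M × M) → M → M}
    {Q : (Fin q → M × M) → M → M} {P' : (Fin p → M₁ × M₁) → M₁ → M₁}
    {Q' : (Fin q → M₁ × M₁) → M₁ → M₁}
    (hP : ∀ X z, φ (P X z) = P' (fun j => Prod.map φ φ (X j)) (φ z))
    (hQ : ∀ X z, φ (Q X z) = Q' (fun j => Prod.map φ φ (X j)) (φ z)) (X : Fin N → M × M) (z : M) :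
    φ (circ h P Q X z) = circ h P' Q' (fun j => Prod.map φ φ (X j)) (φ z) := by
  have h1 : ∀ (k : Fin p) (e : Fin p → Fin N) (e' : Fin q → Fin N),
      φ (insertPair P Q k e e' X z) =
        insertPair P' Q' k e e' (fun j => Prod.map φ φ (X j)) (φ z) := by
    intro k e e'
    simp only [insertPair, map_add, hP, comp_update, hQ]
    rfl
  have h2 : ∀ (e : Fin p → Fin N) (e' : Fin q → Fin N),
      φ (insertLast P Q e e' X z) =
        insertLast P' Q' e e' (fun j => Prod.map φ φ (X j)) (φ z) := by
    intro e e'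
    simp only [insertLast, hP, hQ]
    rfl
  simp only [circ, Pi.add_apply, Finset.sum_apply, Pi.smul_apply, map_add, map_sum, map_zsmul,
    h1, h2]

end bilinear

variable (𝕜 M) in
/-- The product `(P, Q) ↦ P ∘ Q` on cochains with values in `M`. -/
def circL {p q N : ℕ} (h : p + q = N) :
    Cochain 𝕜 M M p →ₗ[𝕜] Cochain 𝕜 M M q →ₗ[𝕜] Cochain 𝕜 M M N :=
  LinearMap.mk₂ 𝕜 (fun P Q => ⟨circ h P.1 Q.1, isCochain_circ h P.2 Q.2⟩)
    (fun P P' Q => Subtype.ext (circ_add_left h P.1 P'.1 Q.1))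
    (fun a P Q => Subtype.ext (circ_smul_left h a P.1 Q.1))
    (fun P Q Q' => Subtype.ext (circ_add_right h P.2.toIsPairSkew Q.1 Q'.1))
    (fun a P Q => Subtype.ext (circ_smul_right h a P.2.toIsPairSkew Q.1))

variable (𝕜 M) in
/-- The bracket `[P, Q] = P ∘ Q - (-1)^{pq} Q ∘ P`. -/
def bracket (p q : ℕ) : Cochain 𝕜 M M p →ₗ[𝕜] Cochain 𝕜 M M q →ₗ[𝕜] Cochain 𝕜 M M (p + q) :=
  circL 𝕜 M rfl
    - (-1 : 𝕜) ^ (p * q) • (circL 𝕜 M (Nat.add_comm q p)).flip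

theorem bracket_apply (p q : ℕ) (P : Cochain 𝕜 M M p) (Q : Cochain 𝕜 M M q)
    (X : Fin (p + q) → M × M) (z : M) :
    (bracket 𝕜 M p q P Q).1 X z =
      circ rfl P.1 Q.1 X z - (-1 : 𝕜) ^ (p * q) • circ (Nat.add_comm q p) Q.1 P.1 X z := rfl

theorem bracket_natural (φ : M →ₗ[𝕜] M₁) {p q : ℕ} {P : Cochain 𝕜 M M p} {Q : Cochain 𝕜 M M q}
    {P' : Cochain 𝕜 M₁ M₁ p} {Q' : Cochain 𝕜 M₁ M₁ q}
    (hP : ∀ X z, φ (P.1 X z) = P'.1 (fun j => Prod.map φ φ (X j)) (φ z))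
    (hQ : ∀ X z, φ (Q.1 X z) = Q'.1 (fun j => Prod.map φ φ (X j)) (φ z))
    (X : Fin (p + q) → M × M) (z : M) :
    φ ((bracket 𝕜 M p q P Q).1 X z) =
      (bracket 𝕜 M₁ p q P' Q').1 (fun j => Prod.map φ φ (X j)) (φ z) := by
  rw [bracket_apply, bracket_apply, map_sub, map_smul, circ_natural _ φ hP hQ,
    circ_natural _ φ hQ hP]

end Cochains

/-! ### The embedding `ν` and the projection `𝒫`

`g × g` is `g ⊕ g'`: the first summand is `g` and the second one its copy `g'`. -/

section Pair

variable (𝕜 : Type*) [Field 𝕜] (g : Type*) [AddCommGroup g] [Module 𝕜 g]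

/-- The grading involution of `g ⊕ g'`: identity on `g` and minus the identity on `g'`. -/
def gradingInvolution : g × g →ₗ[𝕜] g × g :=
  LinearMap.prodMap LinearMap.id (-LinearMap.id)

/-- `V_rPair`: the cochains on `g ⊕ g'` that are even for the `ℤ/2`-grading in which `g` is even
and `g'` is odd, i.e. the number of inputs from `g'` has the parity of the output. -/
def VrPair (n : ℕ) : Submodule 𝕜 (Cochain 𝕜 (g × g) (g × g) n) where
  carrier := {F | ∀ X z, gradingInvolution 𝕜 g (F.1 X z) =
    F.1 (fun j => Prod.map (gradingInvolution 𝕜 g) (gradingInvolution 𝕜 g) (X j))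
      (gradingInvolution 𝕜 g z)}
  zero_mem' := by intro X z; simp
  add_mem' := by
    intro F G hF hG X z
    simp only [Submodule.coe_add, Pi.add_apply, map_add, hF X z, hG X z]
  smul_mem' := by
    intro a F hF X z
    simp only [Submodule.coe_smul, Pi.smul_apply, map_smul, hF X z]

/-- `V_rPair` is closed under the bracket. -/
def rBracket (p q : ℕ) : VrPair 𝕜 g p →ₗ[𝕜] VrPair 𝕜 g q →ₗ[𝕜] VrPair 𝕜 g (p + q) :=
  LinearMap.mk₂ 𝕜
    (fun P Q => ⟨bracket 𝕜 (g × g) p q P.1 Q.1, fun X z => bracket_natural _ P.2 Q.2 X z⟩)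
    (fun P P' Q => Subtype.ext (by simp)) (fun a P Q => Subtype.ext (by simp))
    (fun P Q Q' => Subtype.ext (by simp)) (fun a P Q => Subtype.ext (by simp))

/-- `(x, x') ↦ x + x'`. -/
def sumMap : g × g →ₗ[𝕜] g := LinearMap.fst 𝕜 g g + LinearMap.snd 𝕜 g g

/-- `(x, x') ↦ x - x'`. -/
def diffMap : g × g →ₗ[𝕜] g := LinearMap.fst 𝕜 g g - LinearMap.snd 𝕜 g g

variable [CharZero 𝕜]

/-- The even extension of a cochain on `g` to `g ⊕ g'`, with underlying map to all cochains:
on inputs each of which lies in `g` or in `g'`, the value is that of `f`, placed in `g` if the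
number of inputs from `g'` is even and in `g'` if it is odd (see `nu_apply`).  The formula is
this extension written in the coordinates `x + x'` and `x - x'`. -/
def nuFull (n : ℕ) : Cochain 𝕜 g g n →ₗ[𝕜] Cochain 𝕜 (g × g) (g × g) n :=
  Cochain.comp ((2⁻¹ : 𝕜) • (LinearMap.inl 𝕜 g g + LinearMap.inr 𝕜 g g)) (sumMap 𝕜 g) n
    + Cochain.comp ((2⁻¹ : 𝕜) • (LinearMap.inl 𝕜 g g - LinearMap.inr 𝕜 g g)) (diffMap 𝕜 g) n

variable {𝕜 g}

theorem sumMap_nuFull {n : ℕ} (f : Cochain 𝕜 g g n) (X : Fin n → (g × g) × (g × g)) (z : g × g) :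
    sumMap 𝕜 g ((nuFull 𝕜 g n f).1 X z) =
      f.1 (fun j => Prod.map (sumMap 𝕜 g) (sumMap 𝕜 g) (X j)) (sumMap 𝕜 g z) := by
  simp only [nuFull, Cochain.comp, sumMap, diffMap, LinearMap.add_apply, LinearMap.sub_apply,
    LinearMap.coe_mk, AddHom.coe_mk, LinearMap.smul_apply, Submodule.coe_add, Pi.add_apply,
    LinearMap.inl_apply, LinearMap.inr_apply, LinearMap.fst_apply, LinearMap.snd_apply,
    Prod.fst_add, Prod.snd_add, Prod.smul_fst, Prod.smul_snd, Prod.fst_sub, Prod.snd_sub]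
  module

theorem diffMap_nuFull {n : ℕ} (f : Cochain 𝕜 g g n) (X : Fin n → (g × g) × (g × g))
    (z : g × g) : diffMap 𝕜 g ((nuFull 𝕜 g n f).1 X z) =
      f.1 (fun j => Prod.map (diffMap 𝕜 g) (diffMap 𝕜 g) (X j)) (diffMap 𝕜 g z) := by
  simp only [nuFull, Cochain.comp, sumMap, diffMap, LinearMap.add_apply, LinearMap.sub_apply,
    LinearMap.coe_mk, AddHom.coe_mk, LinearMap.smul_apply, Submodule.coe_add, Pi.add_apply,
    LinearMap.inl_apply, LinearMap.inr_apply, LinearMap.fst_apply, LinearMap.snd_apply,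
    Prod.fst_add, Prod.snd_add, Prod.smul_fst, Prod.smul_snd, Prod.fst_sub, Prod.snd_sub]
  module

theorem ext_sum_diff {u v : g × g} (h : sumMap 𝕜 g u = sumMap 𝕜 g v)
    (h' : diffMap 𝕜 g u = diffMap 𝕜 g v) : u = v := by
  have e : ∀ w : g × g, w = ((2⁻¹ : 𝕜) • (sumMap 𝕜 g w + diffMap 𝕜 g w),
      (2⁻¹ : 𝕜) • (sumMap 𝕜 g w - diffMap 𝕜 g w)) := by
    intro w
    ext
    · simp only [sumMap, diffMap, LinearMap.add_apply, LinearMap.sub_apply, LinearMap.fst_apply,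
        LinearMap.snd_apply]
      module
    · simp only [sumMap, diffMap, LinearMap.add_apply, LinearMap.sub_apply, LinearMap.fst_apply,
        LinearMap.snd_apply]
      module
  rw [e u, e v, h, h']

theorem sumMap_gradingInvolution (u : g × g) :
    sumMap 𝕜 g (gradingInvolution 𝕜 g u) = diffMap 𝕜 g u := by
  simp [sumMap, diffMap, gradingInvolution, sub_eq_add_neg]

theorem diffMap_gradingInvolution (u : g × g) :
    diffMap 𝕜 g (gradingInvolution 𝕜 g u) = sumMap 𝕜 g u := by
  simp [sumMap, diffMap, gradingInvolution]

theorem nuFull_mem {n : ℕ} (f : Cochain 𝕜 g g n) : nuFull 𝕜 g n f ∈ VrPair 𝕜 g n := by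
  intro X z
  apply ext_sum_diff (𝕜 := 𝕜)
  · rw [sumMap_gradingInvolution, diffMap_nuFull, sumMap_nuFull, sumMap_gradingInvolution]
    simp only [Prod.map, sumMap_gradingInvolution]
  · rw [diffMap_gradingInvolution, diffMap_nuFull, sumMap_nuFull, diffMap_gradingInvolution]
    simp only [Prod.map, diffMap_gradingInvolution]

variable (𝕜 g) in
/-- The embedding `ν : V_Pair(n) → V_rPair(n)`. -/
def nu (n : ℕ) : Cochain 𝕜 g g n →ₗ[𝕜] VrPair 𝕜 g n :=
  (nuFull 𝕜 g n).codRestrict _ nuFull_mem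

variable (𝕜 g) in
theorem nu_injective (n : ℕ) : Injective (nu 𝕜 g n) := by
  intro f f' h
  apply Subtype.ext
  funext X z
  have h1 := sumMap_nuFull f (fun j => (((X j).1, 0), ((X j).2, 0))) (z, 0)
  have h2 := sumMap_nuFull f' (fun j => (((X j).1, 0), ((X j).2, 0))) (z, 0)
  rw [show nuFull 𝕜 g n f = nuFull 𝕜 g n f' from congrArg Subtype.val h, h2] at h1
  simpa [sumMap] using h1.symm

theorem nu_bracket (p q : ℕ) (f : Cochain 𝕜 g g p) (f' : Cochain 𝕜 g g q) :
    nu 𝕜 g (p + q) (bracket 𝕜 g p q f f') = rBracket 𝕜 g p q (nu 𝕜 g p f) (nu 𝕜 g q f') := by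
  apply Subtype.ext
  apply Subtype.ext
  funext X z
  apply ext_sum_diff (𝕜 := 𝕜)
  · exact (sumMap_nuFull _ X z).trans
      (bracket_natural _ (sumMap_nuFull f) (sumMap_nuFull f') X z).symm
  · exact (diffMap_nuFull _ X z).trans
      (bracket_natural _ (diffMap_nuFull f) (diffMap_nuFull f') X z).symm

/-- The copy of `x` in `g` (for `a = 0`) or in `g'` (for `a = 1`). -/
def copy (a : ZMod 2) (x : g) : g × g := if a = 0 then (x, 0) else (0, x)

/-- The value of `ν f` on inputs from `g` or `g'`; in particular, if both vectors of each pair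
come from the same summand, then the value lies in the summand of `z`. -/
theorem nu_apply {n : ℕ} (f : Cochain 𝕜 g g n) (a b : Fin n → ZMod 2) (c : ZMod 2)
    (X : Fin n → g × g) (z : g) :
    (nu 𝕜 g n f).1.1 (fun j => (copy (a j) (X j).1, copy (b j) (X j).2)) (copy c z) =
      copy (∑ j, (a j + b j) + c) (f.1 X z) := by
  let ε : ZMod 2 → 𝕜 := fun a => if a = 0 then 1 else -1
  have hs : ∀ a (x : g), sumMap 𝕜 g (copy a x) = x := by
    intro a x; simp only [copy]; split_ifs <;> simp [sumMap]
  have hd : ∀ a (x : g), diffMap 𝕜 g (copy a x) = ε a • x := by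
    intro a x; simp only [copy, ε]; split_ifs <;> simp [diffMap]
  have hε : ∀ a b, ε (a + b) = ε a * ε b := by
    intro a b
    have h2 : ∀ a b : ZMod 2, (a = 0 ∧ b = 0 ∧ a + b = 0) ∨ (a = 0 ∧ b ≠ 0 ∧ a + b ≠ 0) ∨
        (a ≠ 0 ∧ b = 0 ∧ a + b ≠ 0) ∨ (a ≠ 0 ∧ b ≠ 0 ∧ a + b = 0) := by decide
    simp only [ε]
    rcases h2 a b with ⟨h, h', h''⟩ | ⟨h, h', h''⟩ | ⟨h, h', h''⟩ | ⟨h, h', h''⟩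
    · rw [if_pos h, if_pos h', if_pos h'', one_mul]
    · rw [if_pos h, if_neg h', if_neg h'', one_mul]
    · rw [if_neg h, if_pos h', if_neg h'', mul_one]
    · rw [if_neg h, if_neg h', if_pos h'']; norm_num
  have hε0 : ε 0 = 1 := by simp [ε]
  have key : ∀ s : Finset (Fin n),
      f.1 (fun j => if j ∈ s then (ε (a j) • (X j).1, ε (b j) • (X j).2) else X j) z =
        ε (∑ j ∈ s, (a j + b j)) • f.1 X z := by
    intro s
    induction s using Finset.induction_on with
    | empty => simp [hε0]
    | insert i s hi ih =>
      have e1 : (fun j => if j ∈ insert i s then (ε (a j) • (X j).1, ε (b j) • (X j).2) else X j) =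
          update (fun j => if j ∈ s then (ε (a j) • (X j).1, ε (b j) • (X j).2) else X j) i
            (ε (a i) • (X i).1, ε (b i) • (X i).2) := by
        funext j
        by_cases hj : j = i
        · subst hj; simp
        · simp [hj]
      have e2 : update (fun j => if j ∈ s then (ε (a j) • (X j).1, ε (b j) • (X j).2) else X j) i
            ((X i).1, (X i).2) =
          fun j => if j ∈ s then (ε (a j) • (X j).1, ε (b j) • (X j).2) else X j := by
        funext j
        by_cases hj : j = i
        · subst hj; simp [hi]
        · simp [hj]
      rw [e1, f.2.smul_fst, f.2.toIsPairSkew.smul_snd, e2, ih, Finset.sum_insert hi, hε, hε,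
        mul_smul, mul_smul]
  apply ext_sum_diff (𝕜 := 𝕜)
  · refine (sumMap_nuFull _ _ _).trans ?_
    simp only [Prod.map, hs]
  · refine (diffMap_nuFull _ _ _).trans ?_
    have := key Finset.univ
    simp only [Finset.mem_univ, if_true] at this
    simp only [Prod.map, hd, f.2.smul_last, this, smul_smul, hε]
    rw [mul_comm]

variable (𝕜 g) in
/-- The bracket `ν⁻¹ [ν f, ν f']` on `V_Pair`. -/
def pairBracket (p q : ℕ) :
    Cochain 𝕜 g g p →ₗ[𝕜] Cochain 𝕜 g g q →ₗ[𝕜] Cochain 𝕜 g g (p + q) :=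
  let inv (f : Cochain 𝕜 g g p) (f' : Cochain 𝕜 g g q) : Cochain 𝕜 g g (p + q) :=
    (LinearEquiv.ofInjective (nu 𝕜 g (p + q)) (nu_injective 𝕜 g (p + q))).symm
      ⟨rBracket 𝕜 g p q (nu 𝕜 g p f) (nu 𝕜 g q f'), _, nu_bracket p q f f'⟩
  have hinv (f : Cochain 𝕜 g g p) (f' : Cochain 𝕜 g g q) : inv f f' = bracket 𝕜 g p q f f' := by
    rw [LinearEquiv.symm_apply_eq]
    exact Subtype.ext (nu_bracket p q f f').symm
  LinearMap.mk₂ 𝕜 inv (by simp [hinv]) (by simp [hinv]) (by simp [hinv]) (by simp [hinv])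

/-! ### The graded spaces and the operations `l_k` -/

variable (𝕜 g)

/-- A family of bilinear maps of degree `0` on the components, as a bilinear map of graded
spaces. -/
def gradedBilinear {A B C : ℕ → Type*} [∀ n, AddCommMonoid (A n)] [∀ n, Module 𝕜 (A n)]
    [∀ n, AddCommMonoid (B n)] [∀ n, Module 𝕜 (B n)] [∀ n, AddCommMonoid (C n)]
    [∀ n, Module 𝕜 (C n)] (β : ∀ p q, A p →ₗ[𝕜] B q →ₗ[𝕜] C (p + q)) :
    DirectSum ℕ A →ₗ[𝕜] DirectSum ℕ B →ₗ[𝕜] DirectSum ℕ C :=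
  DirectSum.toModule 𝕜 ℕ _ fun p =>
    (DirectSum.toModule 𝕜 ℕ _ fun q =>
      ((β p q).compr₂ (DirectSum.lof 𝕜 ℕ C (p + q))).flip).flip

/-- `V_Pair`, the direct sum of the spaces of cochains of degree `n ≥ 0` on `g`. -/
abbrev VPair : Type _ := DirectSum ℕ fun n => Cochain 𝕜 g g n

/-- `𝔞`, the direct sum of the spaces of cochains of degree `n ≥ 0` on `g'` with values in `g`. -/
abbrev OperatorSpace : Type _ := DirectSum ℕ fun n => Cochain 𝕜 g g n

/-- The graded Lie algebra of all cochains on `g ⊕ g'`. -/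
abbrev BigSpace : Type _ := DirectSum ℕ fun n => Cochain 𝕜 (g × g) (g × g) n

/-- The bracket of the graded Lie algebra of all cochains on `g ⊕ g'`. -/
def bigBracket : BigSpace 𝕜 g →ₗ[𝕜] BigSpace 𝕜 g →ₗ[𝕜] BigSpace 𝕜 g :=
  gradedBilinear 𝕜 (bracket 𝕜 (g × g))

/-- The inclusion of `𝔞`: a cochain on `g'` with values in `g` is extended by zero. -/
def inclA : OperatorSpace 𝕜 g →ₗ[𝕜] BigSpace 𝕜 g :=
  DirectSum.lmap fun n => Cochain.comp (LinearMap.inl 𝕜 g g) (LinearMap.snd 𝕜 g g) n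

/-- The projection `𝒫` onto `𝔞`: restriction to `g'`, followed by the projection to `g`. -/
def projA : BigSpace 𝕜 g →ₗ[𝕜] OperatorSpace 𝕜 g :=
  DirectSum.lmap fun n => Cochain.comp (LinearMap.fst 𝕜 g g) (LinearMap.inr 𝕜 g g) n

/-- The iterated bracket `F ↦ [⋯[[F, θ₁], θ₂], …, θₘ]`. -/
def nested : List (OperatorSpace 𝕜 g) → BigSpace 𝕜 g →ₗ[𝕜] BigSpace 𝕜 g
  | [] => LinearMap.id
  | θ :: l => nested l ∘ₗ (bigBracket 𝕜 g).flip (inclA 𝕜 g θ)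

/-- Multiplication by `(-1)^{d n}` in degree `n`: the Koszul sign of moving an element of
degree `d` past an element of degree `n`. -/
def koszul {A : ℕ → Type*} [∀ n, AddCommMonoid (A n)] [∀ n, Module 𝕜 (A n)] (d : ℕ) :
    DirectSum ℕ A →ₗ[𝕜] DirectSum ℕ A :=
  DirectSum.lmap fun n => (-1 : 𝕜) ^ (d * n) • LinearMap.id

/-- The part of `l_{m+1}(α₀, …, αₘ)` that takes `x[1]` from the entry `i` and `θ` from all others:
`± 𝒫 [⋯[x, θ₀], … θ̂ᵢ …, θₘ]`, where `x` is viewed as a cochain on `g ⊕ g'` by `emb`, and the sign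
comes from moving `x[1]`, of degree `n - 1 ≡ n + 1` modulo `2`, past the `θⱼ` with `j < i`. -/
def mixedPart {W : ℕ → Type*} [∀ n, AddCommMonoid (W n)] [∀ n, Module 𝕜 (W n)]
    (emb : ∀ n, W n →ₗ[𝕜] Cochain 𝕜 (g × g) (g × g) n) {m : ℕ}
    (α : Fin (m + 1) → DirectSum ℕ W × OperatorSpace 𝕜 g) (i : Fin (m + 1)) :
    OperatorSpace 𝕜 g :=
  DirectSum.toModule 𝕜 ℕ (OperatorSpace 𝕜 g)
    (fun n => projA 𝕜 g
      ∘ₗ nested 𝕜 g (List.ofFn fun j : Fin m =>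
          if i.succAbove j < i then koszul 𝕜 (n + 1) (α (i.succAbove j)).2
          else (α (i.succAbove j)).2)
      ∘ₗ DirectSum.lof 𝕜 ℕ (fun n => Cochain 𝕜 (g × g) (g × g) n) n
      ∘ₗ emb n)
    (α i).1

/-- The derived-bracket operations `l_k`, `k ≥ 1`, on `W[1] ⊕ 𝔞`, for a graded space `W` with a
bracket `br` and an embedding `emb` into the cochains on `g ⊕ g'`:
`l₂(x[1], y[1]) = (-1)^{|x|} [x, y][1]` and
`l_k(x[1], θ₁, …, θ_{k-1}) = 𝒫[⋯[[x, θ₁], θ₂], …, θ_{k-1}]`,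
extended to all entries by multilinearity and graded symmetry; on all other types of entries,
they vanish. -/
def derivedOps {W : ℕ → Type*} [∀ n, AddCommMonoid (W n)] [∀ n, Module 𝕜 (W n)]
    (emb : ∀ n, W n →ₗ[𝕜] Cochain 𝕜 (g × g) (g × g) n)
    (br : ∀ p q, W p →ₗ[𝕜] W q →ₗ[𝕜] W (p + q)) :
    (k : ℕ) → (Fin k → DirectSum ℕ W × OperatorSpace 𝕜 g) → DirectSum ℕ W × OperatorSpace 𝕜 g
  | 0, _ => 0
  | 2, α => (gradedBilinear 𝕜 br (koszul 𝕜 1 (α 0).1) (α 1).1, ∑ i, mixedPart 𝕜 g emb α i)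
  | _ + 1, α => (0, ∑ i, mixedPart 𝕜 g emb α i)

/-- The space `V_rPair[1] ⊕ 𝔞`. -/
abbrev LrSpace : Type _ := (DirectSum ℕ fun n => VrPair 𝕜 g n) × OperatorSpace 𝕜 g

/-- The operations `l_k` on `V_rPair[1] ⊕ 𝔞`. -/
def lmRB : (k : ℕ) → (Fin k → LrSpace 𝕜 g) → LrSpace 𝕜 g :=
  derivedOps 𝕜 g (fun n => (VrPair 𝕜 g n).subtype) (rBracket 𝕜 g)

/-- The space `V_Pair[1] ⊕ 𝔞`; a cochain of degree `n` has degree `n - 1` in the first summand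
and degree `n` in the second one. -/
abbrev LSpace : Type _ := VPair 𝕜 g × OperatorSpace 𝕜 g

/-- The part of degree `0` of `V_Pair[1] ⊕ 𝔞`. -/
def degreeZero : Submodule 𝕜 (LSpace 𝕜 g) :=
  (LinearMap.range (DirectSum.lof 𝕜 ℕ (fun n => Cochain 𝕜 g g n) 1)).prod
    (LinearMap.range (DirectSum.lof 𝕜 ℕ (fun n => Cochain 𝕜 g g n) 0))

/-- The operations `l_k` on `V_Pair[1] ⊕ 𝔞`, with the bracket `ν⁻¹ [ν f, ν f']` on `V_Pair`. -/
def lab : (k : ℕ) → (Fin k → LSpace 𝕜 g) → LSpace 𝕜 g :=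
  derivedOps 𝕜 g (fun n => (VrPair 𝕜 g n).subtype ∘ₗ nu 𝕜 g n) (pairBracket 𝕜 g)

/-- The map `(f[1], θ) ↦ (ν(f)[1], θ)`. -/
def nuTilde : LSpace 𝕜 g →ₗ[𝕜] LrSpace 𝕜 g :=
  LinearMap.prodMap (DirectSum.lmap fun n => nu 𝕜 g n) LinearMap.id

end Pair

/-! ### Maurer-Cartan elements -/

/-- `α` is a Maurer-Cartan element for operations `l_k` (`k ≥ 1`) on a space with degree-zero part
`L₀`: it lies in `L₀` and `∑_{k ≥ 1} (1 / k!) l_k(α, …, α) = 0`, where the partial sums are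
eventually constant. -/
def IsMaurerCartan {𝕜 L : Type*} [Field 𝕜] [AddCommGroup L] [Module 𝕜 L] (L₀ : Submodule 𝕜 L)
    (l : (k : ℕ) → (Fin k → L) → L) (α : L) : Prop :=
  α ∈ L₀ ∧ ∃ K : ℕ, ∀ n ≥ K,
    ∑ k ∈ Finset.Icc 1 n, ((k.factorial : 𝕜)⁻¹) • l k (fun _ => α) = 0

/-! ### The element `(π[1], T)` -/

section Elements

variable {𝕜 g : Type*} [Field 𝕜] [AddCommGroup g] [Module 𝕜 g]

theorem update_vec_two (x y z w : g) : update ![x, y, z] 2 w = ![x, y, w] := by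
  funext j; fin_cases j <;> rfl

theorem update_vec_zero (x y z w : g) : update ![x, y, z] 0 w = ![w, y, z] := by
  funext j; fin_cases j <;> rfl

/-- A skew-symmetric trilinear map as a cochain of degree `1`. -/
def threeCochain (π : g [⋀^Fin 3]→ₗ[𝕜] g) : Cochain 𝕜 g g 1 :=
  ⟨fun X z => π ![(X 0).1, (X 0).2, z],
    { add_last := fun X z z' => by
        have := π.map_update_add ![(X 0).1, (X 0).2, 0] 2 z z'
        simpa only [update_vec_two] using this
      smul_last := fun X c z => by
        have := π.map_update_smul ![(X 0).1, (X 0).2, 0] 2 c z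
        simpa only [update_vec_two] using this
      add_fst := fun X i x x' y z => by
        obtain rfl := Subsingleton.elim i 0
        have := π.map_update_add ![0, y, z] 0 x x'
        simpa only [update_vec_zero, update_self] using this
      smul_fst := fun X i c x y z => by
        obtain rfl := Subsingleton.elim i 0
        have := π.map_update_smul ![0, y, z] 0 c x
        simpa only [update_vec_zero, update_self] using this
      swap := fun X i x y z => by
        obtain rfl := Subsingleton.elim i 0
        have := π.map_swap ![x, y, z] (show (0 : Fin 3) ≠ 1 by decide)
        simp only [update_self]
        rw [← this]
        congr 1
        funext j
        fin_cases j <;> rfl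
      swap_last := fun X i _ x y z => by
        obtain rfl := Subsingleton.elim i 0
        have := π.map_swap ![x, y, z] (show (1 : Fin 3) ≠ 2 by decide)
        simp only [update_self]
        rw [← this]
        congr 1
        funext j
        fin_cases j <;> rfl }⟩

/-- A linear map as a cochain of degree `0`. -/
def oneCochain (T : g →ₗ[𝕜] g) : Cochain 𝕜 g g 0 :=
  ⟨fun _ z => T z,
    { add_last := fun _ z z' => map_add T z z'
      smul_last := fun _ c z => map_smul T c z
      add_fst := fun _ i => i.elim0
      smul_fst := fun _ i => i.elim0
      swap := fun _ i => i.elim0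
      swap_last := fun _ i => i.elim0 }⟩

/-- The element `(π[1], T)` of `V_Pair[1] ⊕ 𝔞`. -/
def structureElement (π : g [⋀^Fin 3]→ₗ[𝕜] g) (T : g →ₗ[𝕜] g) : LSpace 𝕜 g :=
  (DirectSum.lof 𝕜 ℕ (fun n => Cochain 𝕜 g g n) 1 (threeCochain π),
    DirectSum.lof 𝕜 ℕ (fun n => Cochain 𝕜 g g n) 0 (oneCochain T))

end Elements

end

end ThreeLie

/-!
The Maurer-Cartan equation for `(π[1], θ)`, with `θ = s⁻¹ T`, splits into its two components.

The component in `V_Pair[1]` only sees `l₂` and is `-½ [π, π] = 0`. As `[π, π] = 2 π ∘ π` and `π ∘ π`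
is the defect of the fundamental identity, this says that `π` is a 3-Lie bracket
(`bracket_self_eq_zero_iff`).

In the component in `𝔞`, the term of `l_{m+1}` divided by `(m+1)!` is `Dₘ / m!`, where `Dₘ` is
`𝒫 [⋯[ν π, θ], …, θ]` with `m` brackets (`derivedCochain`). Extended by zero to `g ⊕ g'`, the map
`θ` becomes the square-zero endomorphism `N = shift θ`. Bracketing with `N` is a sum of four
commuting operators, each of square zero: `N` is put into one of the three inputs, or, with a
minus sign, applied to the output. Hence the `m`-th iterate is `m!` times a sum of products of `m`
distinct operators, and the fifth one vanishes (`twist_iterate_five`). Since `ν π` preserves parity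
and all inputs are odd, the output of `ν π` lies in `g` exactly if an odd number of inputs has been
replaced, and `𝒫` keeps either the terms with such an output, or those in which `N` is
applied to an output in `g'`. So only `D₁` and `D₃` survive, and the equation reads
`π(θu,v,w) + π(u,θv,w) + π(u,v,θw) - θπ(u,v,w)
  + π(θu,θv,θw) - θ(π(θu,θv,w) + π(θu,v,θw) + π(u,θv,θw)) = 0`.
Multiplied by `s³`, it is the modified Rota-Baxter identity of weight `s²`
(`derivedCochain_eq_zero_iff`).

The comparison of the two families of operations holds because `ν` is compatible with the brackets
and both families are built from the same cochains on `g ⊕ g'` (`nuTilde_lab`).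
-/

namespace ThreeLie

open Function

set_option maxSynthPendingDepth 3

noncomputable section

/-! ### Graded bilinear maps and the comparison of the two families of operations -/

section Graded

variable {𝕜 : Type*} [Field 𝕜]

theorem gradedBilinear_lof_lof {A B C : ℕ → Type*} [∀ n, AddCommMonoid (A n)]
    [∀ n, Module 𝕜 (A n)] [∀ n, AddCommMonoid (B n)] [∀ n, Module 𝕜 (B n)]
    [∀ n, AddCommMonoid (C n)] [∀ n, Module 𝕜 (C n)]
    (β : ∀ p q, A p →ₗ[𝕜] B q →ₗ[𝕜] C (p + q)) (p q : ℕ) (a : A p) (b : B q) :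
    gradedBilinear 𝕜 β (DirectSum.lof 𝕜 ℕ A p a) (DirectSum.lof 𝕜 ℕ B q b) =
      DirectSum.lof 𝕜 ℕ C (p + q) (β p q a b) := by
  simp [gradedBilinear]

theorem lmap_gradedBilinear {A A' B B' C C' : ℕ → Type*} [∀ n, AddCommMonoid (A n)]
    [∀ n, Module 𝕜 (A n)] [∀ n, AddCommMonoid (B n)] [∀ n, Module 𝕜 (B n)]
    [∀ n, AddCommMonoid (C n)] [∀ n, Module 𝕜 (C n)] [∀ n, AddCommMonoid (A' n)]
    [∀ n, Module 𝕜 (A' n)] [∀ n, AddCommMonoid (B' n)] [∀ n, Module 𝕜 (B' n)]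
    [∀ n, AddCommMonoid (C' n)] [∀ n, Module 𝕜 (C' n)]
    {β : ∀ p q, A p →ₗ[𝕜] B q →ₗ[𝕜] C (p + q)} {β' : ∀ p q, A' p →ₗ[𝕜] B' q →ₗ[𝕜] C' (p + q)}
    {φ : ∀ n, A n →ₗ[𝕜] A' n} {ψ : ∀ n, B n →ₗ[𝕜] B' n} {χ : ∀ n, C n →ₗ[𝕜] C' n}
    (h : ∀ p q a b, χ (p + q) (β p q a b) = β' p q (φ p a) (ψ q b))
    (x : DirectSum ℕ A) (y : DirectSum ℕ B) :
    DirectSum.lmap χ (gradedBilinear 𝕜 β x y) =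
      gradedBilinear 𝕜 β' (DirectSum.lmap φ x) (DirectSum.lmap ψ y) := by
  suffices (gradedBilinear 𝕜 β).compr₂ (DirectSum.lmap χ) =
      (gradedBilinear 𝕜 β').compl₁₂ (DirectSum.lmap φ) (DirectSum.lmap ψ) from
    LinearMap.congr_fun₂ this x y
  ext p a q b : 4
  simp [gradedBilinear_lof_lof, h, DirectSum.lmap_lof]

theorem koszul_lof {A : ℕ → Type*} [∀ n, AddCommMonoid (A n)] [∀ n, Module 𝕜 (A n)] (d n : ℕ)
    (a : A n) : koszul 𝕜 d (DirectSum.lof 𝕜 ℕ A n a) =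
      (-1 : 𝕜) ^ (d * n) • DirectSum.lof 𝕜 ℕ A n a := by
  simp [koszul, DirectSum.lmap_lof]

theorem lmap_koszul {A A' : ℕ → Type*} [∀ n, AddCommMonoid (A n)] [∀ n, Module 𝕜 (A n)]
    [∀ n, AddCommMonoid (A' n)] [∀ n, Module 𝕜 (A' n)] (φ : ∀ n, A n →ₗ[𝕜] A' n) (d : ℕ)
    (x : DirectSum ℕ A) : DirectSum.lmap φ (koszul 𝕜 d x) =
      koszul 𝕜 d (DirectSum.lmap φ x) := by
  suffices DirectSum.lmap φ ∘ₗ koszul 𝕜 d = koszul 𝕜 d ∘ₗ DirectSum.lmap φ from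
    LinearMap.congr_fun this x
  ext n a : 2
  simp [koszul_lof, DirectSum.lmap_lof]

end Graded

section Comparison

variable {𝕜 g : Type*} [Field 𝕜] [AddCommGroup g] [Module 𝕜 g]

section derivedOps

variable {W W' : ℕ → Type*} [∀ n, AddCommMonoid (W n)] [∀ n, Module 𝕜 (W n)]
  [∀ n, AddCommMonoid (W' n)] [∀ n, Module 𝕜 (W' n)]
  (emb : ∀ n, W n →ₗ[𝕜] Cochain 𝕜 (g × g) (g × g) n) (br : ∀ p q, W p →ₗ[𝕜] W q →ₗ[𝕜] W (p + q))

theorem derivedOps_succ_snd (m : ℕ) (α : Fin (m + 1) → DirectSum ℕ W × OperatorSpace 𝕜 g) :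
    (derivedOps 𝕜 g emb br (m + 1) α).2 = ∑ i, mixedPart 𝕜 g emb α i := by
  match m with
  | 0 => rfl
  | 1 => rfl
  | _ + 2 => rfl

theorem derivedOps_two_fst (α : Fin 2 → DirectSum ℕ W × OperatorSpace 𝕜 g) :
    (derivedOps 𝕜 g emb br 2 α).1 =
      gradedBilinear 𝕜 br (koszul 𝕜 1 (α 0).1) (α 1).1 := rfl

theorem derivedOps_fst_of_ne {k : ℕ} (hk : k ≠ 2)
    (α : Fin k → DirectSum ℕ W × OperatorSpace 𝕜 g) : (derivedOps 𝕜 g emb br k α).1 = 0 := by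
  match k with
  | 0 => rfl
  | 1 => rfl
  | 2 => exact absurd rfl hk
  | _ + 3 => rfl

/-- Mixed terms only depend on the image of the first components in the cochains on `g ⊕ g'`. -/
theorem mixedPart_lmap (φ : ∀ n, W' n →ₗ[𝕜] W n) {m : ℕ}
    (α : Fin (m + 1) → DirectSum ℕ W' × OperatorSpace 𝕜 g) (i : Fin (m + 1)) :
    mixedPart 𝕜 g emb (fun j => (DirectSum.lmap φ (α j).1, (α j).2)) i =
      mixedPart 𝕜 g (fun n => emb n ∘ₗ φ n) α i := by
  unfold mixedPart
  dsimp only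
  generalize (α i).1 = x
  rw [← LinearMap.comp_apply]
  congr 1
  ext n a : 2
  simp [DirectSum.lmap_lof]

end derivedOps

variable [CharZero 𝕜]

theorem pairBracket_apply (p q : ℕ) (f : Cochain 𝕜 g g p) (f' : Cochain 𝕜 g g q) :
    pairBracket 𝕜 g p q f f' = bracket 𝕜 g p q f f' := by
  refine ((LinearEquiv.ofInjective (nu 𝕜 g (p + q)) (nu_injective 𝕜 g (p + q))).symm_apply_eq).2 ?_
  exact Subtype.ext (nu_bracket p q f f').symm

theorem nuTilde_injective : Injective (nuTilde 𝕜 g) :=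
  Prod.map_injective.2
    ⟨(DirectSum.lmap_injective _).2 (nu_injective 𝕜 g), injective_id⟩

theorem nuTilde_lab (k : ℕ) (α : Fin k → LSpace 𝕜 g) :
    nuTilde 𝕜 g (lab 𝕜 g k α) = lmRB 𝕜 g k (fun i => nuTilde 𝕜 g (α i)) := by
  refine Prod.ext ?_ ?_
  · change DirectSum.lmap (fun n => nu 𝕜 g n) (lab 𝕜 g k α).1 = _
    by_cases hk : k = 2
    · subst hk
      rw [lab, derivedOps_two_fst, lmRB, derivedOps_two_fst,
        lmap_gradedBilinear (β' := rBracket 𝕜 g) (φ := fun n => nu 𝕜 g n)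
          (ψ := fun n => nu 𝕜 g n), lmap_koszul]
      · rfl
      · intro p q a b
        rw [pairBracket_apply, nu_bracket]
    · rw [lab, lmRB, derivedOps_fst_of_ne _ _ hk, derivedOps_fst_of_ne _ _ hk, map_zero]
  · change (lab 𝕜 g k α).2 = _
    cases k with
    | zero => rfl
    | succ m =>
      rw [lab, lmRB, derivedOps_succ_snd, derivedOps_succ_snd]
      exact Finset.sum_congr rfl fun i _ =>
        (mixedPart_lmap (fun n => (VrPair 𝕜 g n).subtype) (fun n => nu 𝕜 g n) α i).symm

end Comparison

/-! ### Low-degree products -/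

section LowDegree

variable {𝕜 M : Type*} [Field 𝕜] [AddCommGroup M] [Module 𝕜 M]

theorem shuffles_eq_singleton (a : ℕ) {N : ℕ} (hN : N ≤ 1) : shuffles a N = {1} := by
  have : Subsingleton (Fin N) := Fin.subsingleton_iff_le_one.2 hN
  ext σ
  obtain rfl := Subsingleton.elim σ 1
  simp [mem_shuffles]

theorem shuffles_one_two : shuffles 1 2 = {1, Equiv.swap 0 1} := by
  decide

/-- The value of a cochain of degree `1`, viewed as a function of three vectors. -/
def eval₃ (F : Cochain 𝕜 M M 1) (x y z : M) : M := F.1 (fun _ => (x, y)) z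

theorem ext_eval₃ {F G : Cochain 𝕜 M M 1} (h : ∀ x y z, eval₃ F x y z = eval₃ G x y z) :
    F = G := by
  apply Subtype.ext
  funext X z
  have hX : X = fun _ => ((X 0).1, (X 0).2) := by
    funext i
    obtain rfl := Subsingleton.elim i 0
    rfl
  rw [hX]
  exact h _ _ _

theorem update_fin_one {α : Type*} (X : Fin 1 → α) (i : Fin 1) (a : α) :
    update X i a = fun _ => a := by
  funext j
  obtain rfl := Subsingleton.elim j i
  simp

theorem circ_one_zero (F : Cochain 𝕜 M M 1) (N : M →ₗ[𝕜] M) (h : 1 + 0 = 1) (x y z : M) :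
    circ h F.1 (oneCochain N).1 (fun _ => (x, y)) z =
      eval₃ F (N x) y z + eval₃ F x (N y) z + eval₃ F x y (N z) := by
  simp [circ, shuffles_eq_singleton, insertPair, insertLast, update_fin_one, oneCochain,
    eval₃, comp_def]

theorem circ_zero_one (F : Cochain 𝕜 M M 1) (N : M →ₗ[𝕜] M) (h : 0 + 1 = 1) (x y z : M) :
    circ h (oneCochain N).1 F.1 (fun _ => (x, y)) z = N (eval₃ F x y z) := by
  simp [circ, shuffles_eq_singleton, insertLast, oneCochain, eval₃, comp_def]

/-- For `F = G` this is the defect of the fundamental identity. -/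
theorem circ_one_one (F G : Cochain 𝕜 M M 1) (h : 1 + 1 = 2) (X : Fin 2 → M × M) (z : M) :
    circ h F.1 G.1 X z =
      eval₃ F (eval₃ G (X 0).1 (X 0).2 (X 1).1) (X 1).2 z
        + eval₃ F (X 1).1 (eval₃ G (X 0).1 (X 0).2 (X 1).2) z
        + eval₃ F (X 1).1 (X 1).2 (eval₃ G (X 0).1 (X 0).2 z)
        - eval₃ F (X 0).1 (X 0).2 (eval₃ G (X 1).1 (X 1).2 z) := by
  have hc : ∀ (e : Fin 1 → Fin 2), X ∘ e = fun _ => ((X (e 0)).1, (X (e 0)).2) := by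
    intro e
    funext i
    obtain rfl := Subsingleton.elim i 0
    rfl
  simp [circ, shuffles_eq_singleton, shuffles_one_two, insertPair, insertLast, update_fin_one, hc,
    eval₃, outerSlot, innerSlot]
  rw [Finset.sum_pair (by decide)]
  simp
  abel

end LowDegree

/-! ### Iterated brackets with a square-zero map -/

section Twist

variable {𝕜 M : Type*} [Field 𝕜] [AddCommGroup M] [Module 𝕜 M]

variable (𝕜) in
/-- The operator `F ↦ [F, N]` on cochains of degree `1`, for a linear map `N`. -/
def twist (N : M →ₗ[𝕜] M) : Cochain 𝕜 M M 1 →ₗ[𝕜] Cochain 𝕜 M M 1 :=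
  (bracket 𝕜 M 1 0).flip (oneCochain N)

variable (F : Cochain 𝕜 M M 1) (N : M →ₗ[𝕜] M)

theorem eval₃_twist (x y z : M) : eval₃ (twist 𝕜 N F) x y z =
    eval₃ F (N x) y z + eval₃ F x (N y) z + eval₃ F x y (N z) - N (eval₃ F x y z) := by
  refine (bracket_apply 1 0 F (oneCochain N) (fun _ => (x, y)) z).trans ?_
  rw [circ_one_zero, circ_zero_one]
  simp

theorem eval₃_smul_fst (c : 𝕜) (x y z : M) : eval₃ F (c • x) y z = c • eval₃ F x y z := by
  have := F.2.smul_fst (fun _ => 0) 0 c x y z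
  simpa only [update_fin_one, eval₃] using this

theorem eval₃_smul_snd (c : 𝕜) (x y z : M) : eval₃ F x (c • y) z = c • eval₃ F x y z := by
  have := F.2.smul_snd (fun _ => 0) 0 c x y z
  simpa only [update_fin_one, eval₃] using this

theorem eval₃_smul_last (c : 𝕜) (x y z : M) : eval₃ F x y (c • z) = c • eval₃ F x y z :=
  F.2.smul_last _ c z

theorem eval₃_zero_fst (y z : M) : eval₃ F 0 y z = 0 := by
  simpa only [zero_smul] using eval₃_smul_fst F (0 : 𝕜) 0 y z

theorem eval₃_zero_snd (x z : M) : eval₃ F x 0 z = 0 := by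
  simpa only [zero_smul] using eval₃_smul_snd F (0 : 𝕜) x 0 z

theorem eval₃_zero_last (x y : M) : eval₃ F x y 0 = 0 := by
  simpa only [zero_smul] using eval₃_smul_last F (0 : 𝕜) x y 0

variable {N} (hN : ∀ x, N (N x) = 0)
include hN

theorem eval₃_twist_iterate_two (x y z : M) : eval₃ ((twist 𝕜 N)^[2] F) x y z =
    (2 : 𝕜) • (eval₃ F (N x) (N y) z + eval₃ F (N x) y (N z) + eval₃ F x (N y) (N z)
      - N (eval₃ F (N x) y z + eval₃ F x (N y) z + eval₃ F x y (N z))) := by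
  simp only [iterate_succ_apply', iterate_zero_apply, eval₃_twist, hN, eval₃_zero_fst,
    eval₃_zero_snd, eval₃_zero_last, map_add, map_sub]
  module

theorem eval₃_twist_iterate_three (x y z : M) : eval₃ ((twist 𝕜 N)^[3] F) x y z =
    (6 : 𝕜) • (eval₃ F (N x) (N y) (N z)
      - N (eval₃ F (N x) (N y) z + eval₃ F (N x) y (N z) + eval₃ F x (N y) (N z))) := by
  rw [iterate_succ_apply']
  simp only [eval₃_twist, eval₃_twist_iterate_two F hN, hN, eval₃_zero_fst,
    eval₃_zero_snd, eval₃_zero_last, map_add, map_sub, map_smul, map_zero]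
  module

theorem eval₃_twist_iterate_four (x y z : M) : eval₃ ((twist 𝕜 N)^[4] F) x y z =
    -(24 : 𝕜) • N (eval₃ F (N x) (N y) (N z)) := by
  rw [iterate_succ_apply']
  simp only [eval₃_twist, eval₃_twist_iterate_three F hN, hN, eval₃_zero_fst,
    eval₃_zero_snd, eval₃_zero_last, map_add, map_sub, map_smul, map_zero]
  module

/-- Each of the three inputs and the output can absorb a square-zero map at most once. -/
theorem twist_iterate_five : (twist 𝕜 N)^[5] F = 0 := by
  refine ext_eval₃ fun x y z => ?_
  rw [iterate_succ_apply']
  simp only [eval₃_twist, eval₃_twist_iterate_four F hN, hN, eval₃_zero_fst,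
    eval₃_zero_snd, eval₃_zero_last, map_smul, map_zero, smul_zero]
  simp [eval₃]

end Twist

/-! ### The derived cochains of `ν f` -/

section Operator

variable {𝕜 g : Type*} [Field 𝕜] [AddCommGroup g] [Module 𝕜 g]

variable (𝕜) in
/-- The endomorphism `(x, x') ↦ (θ x', 0)` of `g ⊕ g'` given by a linear map `θ : g' → g`. -/
def shift (θ : g →ₗ[𝕜] g) : g × g →ₗ[𝕜] g × g :=
  LinearMap.inl 𝕜 g g ∘ₗ θ ∘ₗ LinearMap.snd 𝕜 g g

theorem shift_shift (θ : g →ₗ[𝕜] g) (x : g × g) : shift 𝕜 θ (shift 𝕜 θ x) = 0 := by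
  simp [shift]

theorem shift_copy_zero (θ : g →ₗ[𝕜] g) (x : g) : shift 𝕜 θ (copy 0 x) = 0 := by
  simp [shift, copy]

theorem shift_copy_one (θ : g →ₗ[𝕜] g) (x : g) : shift 𝕜 θ (copy 1 x) = copy 0 (θ x) := by
  simp [shift, copy]

theorem bigBracket_inclA (F : Cochain 𝕜 (g × g) (g × g) 1) (θ : g →ₗ[𝕜] g) :
    bigBracket 𝕜 g (DirectSum.lof 𝕜 ℕ (fun n => Cochain 𝕜 (g × g) (g × g) n) 1 F)
        (inclA 𝕜 g (DirectSum.lof 𝕜 ℕ (fun n => Cochain 𝕜 g g n) 0 (oneCochain θ))) =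
      DirectSum.lof 𝕜 ℕ (fun n => Cochain 𝕜 (g × g) (g × g) n) 1 (twist 𝕜 (shift 𝕜 θ) F) := by
  rw [inclA, DirectSum.lmap_lof, bigBracket, gradedBilinear_lof_lof]
  rfl

theorem nested_replicate (θ : g →ₗ[𝕜] g) (m : ℕ) (F : Cochain 𝕜 (g × g) (g × g) 1) :
    nested 𝕜 g (List.replicate m
        (DirectSum.lof 𝕜 ℕ (fun n => Cochain 𝕜 g g n) 0 (oneCochain θ)))
        (DirectSum.lof 𝕜 ℕ (fun n => Cochain 𝕜 (g × g) (g × g) n) 1 F) =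
      DirectSum.lof 𝕜 ℕ (fun n => Cochain 𝕜 (g × g) (g × g) n) 1
        ((twist 𝕜 (shift 𝕜 θ))^[m] F) := by
  induction m generalizing F with
  | zero => rfl
  | succ m ih =>
    rw [List.replicate_succ, nested, LinearMap.comp_apply, LinearMap.flip_apply,
      bigBracket_inclA, ih, iterate_succ_apply]

variable [CharZero 𝕜]

theorem eval₃_nu (f : Cochain 𝕜 g g 1) (a b c : ZMod 2) (x y z : g) :
    eval₃ (nu 𝕜 g 1 f).1 (copy a x) (copy b y) (copy c z) = copy (a + b + c) (eval₃ f x y z) := by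
  simpa [eval₃] using nu_apply f (fun _ => a) (fun _ => b) c (fun _ => (x, y)) z

variable (𝕜) in
/-- The cochain `𝒫 [⋯[ν f, θ], …, θ]` on `g' ≅ g`, with `m` brackets. -/
def derivedCochain (θ : g →ₗ[𝕜] g) (m : ℕ) (f : Cochain 𝕜 g g 1) : Cochain 𝕜 g g 1 :=
  Cochain.comp (LinearMap.fst 𝕜 g g) (LinearMap.inr 𝕜 g g) 1
    ((twist 𝕜 (shift 𝕜 θ))^[m] (nu 𝕜 g 1 f).1)

/-- All entries `θ` have degree `0`, so there are no signs, and the mixed term does not depend on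
the entry from which `f` is taken. -/
theorem mixedPart_const (θ : g →ₗ[𝕜] g) (f : Cochain 𝕜 g g 1) (m : ℕ) (i : Fin (m + 1)) :
    mixedPart 𝕜 g (fun n => (VrPair 𝕜 g n).subtype ∘ₗ nu 𝕜 g n)
        (fun _ => (DirectSum.lof 𝕜 ℕ (fun n => Cochain 𝕜 g g n) 1 f,
          DirectSum.lof 𝕜 ℕ (fun n => Cochain 𝕜 g g n) 0 (oneCochain θ))) i =
      DirectSum.lof 𝕜 ℕ (fun n => Cochain 𝕜 g g n) 1 (derivedCochain 𝕜 θ m f) := by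
  simp only [mixedPart, DirectSum.toModule_lof, koszul_lof, mul_zero, pow_zero, one_smul, ite_self,
    List.ofFn_const, LinearMap.comp_apply, nested_replicate, projA, DirectSum.lmap_lof]
  rfl

variable (θ : g →ₗ[𝕜] g) (f : Cochain 𝕜 g g 1)

theorem eval₃_derivedCochain (m : ℕ) (u v w : g) : eval₃ (derivedCochain 𝕜 θ m f) u v w =
    (eval₃ ((twist 𝕜 (shift 𝕜 θ))^[m] (nu 𝕜 g 1 f).1) (copy 1 u) (copy 1 v) (copy 1 w)).1 :=
  rfl

theorem copy_zero_fst (x : g) : (copy 0 x).1 = x := by simp [copy]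

theorem copy_one_fst (x : g) : (copy 1 x).1 = 0 := by simp [copy]

/-- On three inputs from `g'` the value of `ν f` lies in `g'`. -/
theorem derivedCochain_zero : derivedCochain 𝕜 θ 0 f = 0 := by
  refine ext_eval₃ fun u v w => ?_
  rw [eval₃_derivedCochain, iterate_zero_apply, eval₃_nu, show (1 + 1 + 1 : ZMod 2) = 1 by decide,
    copy_one_fst]
  rfl

theorem eval₃_derivedCochain_one (u v w : g) : eval₃ (derivedCochain 𝕜 θ 1 f) u v w =
    eval₃ f (θ u) v w + eval₃ f u (θ v) w + eval₃ f u v (θ w) - θ (eval₃ f u v w) := by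
  simp only [eval₃_derivedCochain, iterate_succ_apply', iterate_zero_apply, eval₃_twist,
    shift_copy_one, eval₃_nu, Prod.fst_add, Prod.fst_sub, show (1 + 1 + 1 : ZMod 2) = 1 by decide,
    show (0 + 1 + 1 : ZMod 2) = 0 by decide, show (1 + 0 + 1 : ZMod 2) = 0 by decide,
    show (1 + 1 + 0 : ZMod 2) = 0 by decide, copy_zero_fst]

/-- With two maps `θ`, the value of `ν f` has the wrong parity: it lies in `g'` if both are put
into inputs, and in `g`, where `shift θ` vanishes, if one of them is applied to it. -/
theorem derivedCochain_two : derivedCochain 𝕜 θ 2 f = 0 := by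
  refine ext_eval₃ fun u v w => ?_
  simp only [eval₃_derivedCochain, eval₃_twist_iterate_two _ (shift_shift θ), map_add,
    shift_copy_one, shift_copy_zero, eval₃_nu, Prod.fst_add, Prod.fst_sub, Prod.smul_fst,
    show (0 + 1 + 1 : ZMod 2) = 0 by decide, show (1 + 0 + 1 : ZMod 2) = 0 by decide,
    show (1 + 1 + 0 : ZMod 2) = 0 by decide, show (0 + 0 + 1 : ZMod 2) = 1 by decide,
    show (0 + 1 + 0 : ZMod 2) = 1 by decide, show (1 + 0 + 0 : ZMod 2) = 1 by decide,
    copy_one_fst]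
  simp [eval₃]

theorem eval₃_derivedCochain_three (u v w : g) : eval₃ (derivedCochain 𝕜 θ 3 f) u v w =
    (6 : 𝕜) • (eval₃ f (θ u) (θ v) (θ w)
      - θ (eval₃ f (θ u) (θ v) w + eval₃ f (θ u) v (θ w) + eval₃ f u (θ v) (θ w))) := by
  simp only [eval₃_derivedCochain, eval₃_twist_iterate_three _ (shift_shift θ), map_add,
    shift_copy_one, eval₃_nu, Prod.fst_add, Prod.fst_sub, Prod.smul_fst,
    show (0 + 0 + 1 : ZMod 2) = 1 by decide, show (0 + 0 + 0 : ZMod 2) = 0 by decide,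
    show (0 + 1 + 0 : ZMod 2) = 1 by decide, show (1 + 0 + 0 : ZMod 2) = 1 by decide,
    copy_zero_fst]

theorem derivedCochain_of_four_le {m : ℕ} (hm : 4 ≤ m) : derivedCochain 𝕜 θ m f = 0 := by
  rcases hm.eq_or_lt with rfl | hm
  -- on three inputs from `g` the value of `ν f` lies in `g`, where `shift θ` vanishes
  · refine ext_eval₃ fun u v w => ?_
    simp only [eval₃_derivedCochain, eval₃_twist_iterate_four _ (shift_shift θ),
      shift_copy_one, shift_copy_zero, eval₃_nu, show (0 + 0 + 0 : ZMod 2) = 0 by decide]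
    simp [eval₃]
  · obtain ⟨k, rfl⟩ := Nat.exists_eq_add_of_le' hm
    rw [derivedCochain, iterate_add_apply, twist_iterate_five _ (shift_shift θ),
      iterate_map_zero, map_zero]

end Operator

/-! ### The Maurer-Cartan equation -/

section MaurerCartan

variable {𝕜 g : Type*} [Field 𝕜] [AddCommGroup g] [Module 𝕜 g]

/-- Both terms of `[π, π] = π ∘ π - (-1)^{1 * 1} π ∘ π` have the same sign. -/
theorem bracket_self_eq_zero_iff [CharZero 𝕜] (π : g [⋀^Fin 3]→ₗ[𝕜] g) :
    bracket 𝕜 g 1 1 (threeCochain π) (threeCochain π) = 0 ↔ IsThreeLieBracket π := by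
  have key : ∀ (X : Fin 2 → g × g) (z : g),
      (bracket 𝕜 g 1 1 (threeCochain π) (threeCochain π)).1 X z =
        (2 : 𝕜) • (π ![π ![(X 0).1, (X 0).2, (X 1).1], (X 1).2, z]
          + π ![(X 1).1, π ![(X 0).1, (X 0).2, (X 1).2], z]
          + π ![(X 1).1, (X 1).2, π ![(X 0).1, (X 0).2, z]]
          - π ![(X 0).1, (X 0).2, π ![(X 1).1, (X 1).2, z]]) := by
    intro X z
    rw [bracket_apply, circ_one_one]
    simp only [eval₃, threeCochain, mul_one, pow_one]
    module
  constructor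
  · intro h x y u v w
    have := key ![(x, y), (u, v)] w
    rw [h] at this
    have := (smul_eq_zero.1 this.symm).resolve_left two_ne_zero
    exact (sub_eq_zero.1 this).symm
  · intro h
    apply Subtype.ext
    funext X z
    rw [key, ← h, sub_self, smul_zero]
    rfl

variable [CharZero 𝕜] (π : g [⋀^Fin 3]→ₗ[𝕜] g) (θ : g →ₗ[𝕜] g)

theorem lab_structureElement_snd (m : ℕ) :
    (lab 𝕜 g (m + 1) fun _ => structureElement π θ).2 =
      ((m + 1 : ℕ) : 𝕜) • DirectSum.lof 𝕜 ℕ (fun n => Cochain 𝕜 g g n) 1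
        (derivedCochain 𝕜 θ m (threeCochain π)) := by
  rw [lab, derivedOps_succ_snd]
  refine (Finset.sum_congr rfl fun i _ => mixedPart_const θ (threeCochain π) m i).trans ?_
  rw [Finset.sum_const, Finset.card_univ, Fintype.card_fin, Nat.cast_smul_eq_nsmul]

theorem lab_two_structureElement_fst :
    (lab 𝕜 g 2 fun _ => structureElement π θ).1 =
      DirectSum.lof 𝕜 ℕ (fun n => Cochain 𝕜 g g n) 2
        (-bracket 𝕜 g 1 1 (threeCochain π) (threeCochain π)) := by
  rw [lab, derivedOps_two_fst, structureElement, koszul_lof, map_smul, LinearMap.smul_apply,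
    gradedBilinear_lof_lof, pairBracket_apply]
  simp

/-- The partial sums are constant from the fourth one on, since `l_k` vanishes on the structure
element for `k ≥ 5`; of the earlier terms, `l₁` and `l₃` vanish as well. -/
theorem sum_lab_structureElement {n : ℕ} (hn : 4 ≤ n) :
    ∑ k ∈ Finset.Icc 1 n, ((k.factorial : 𝕜)⁻¹) • lab 𝕜 g k (fun _ => structureElement π θ) =
      (DirectSum.lof 𝕜 ℕ (fun n => Cochain 𝕜 g g n) 2
          (-(2 : 𝕜)⁻¹ • bracket 𝕜 g 1 1 (threeCochain π) (threeCochain π)),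
        DirectSum.lof 𝕜 ℕ (fun n => Cochain 𝕜 g g n) 1
          (derivedCochain 𝕜 θ 1 (threeCochain π)
            + (6 : 𝕜)⁻¹ • derivedCochain 𝕜 θ 3 (threeCochain π))) := by
  have hsub : Finset.Icc 1 4 ⊆ Finset.Icc 1 n := Finset.Icc_subset_Icc_right hn
  refine Prod.ext ?_ ?_
  · rw [Prod.fst_sum, Finset.sum_eq_single_of_mem 2 (Finset.mem_Icc.2 ⟨by norm_num, by omega⟩)]
    · rw [Prod.smul_fst, lab_two_structureElement_fst]
      simp
    · intro k _ hk
      rw [Prod.smul_fst, lab, derivedOps_fst_of_ne _ _ hk, smul_zero]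
  · rw [Prod.snd_sum, ← Finset.sum_subset hsub]
    · rw [show Finset.Icc 1 4 = {1, 2, 3, 4} from rfl]
      simp only [Prod.smul_snd, Finset.sum_insert, Finset.sum_singleton, Finset.mem_insert,
        Finset.mem_singleton, OfNat.one_ne_ofNat, Nat.reduceEqDiff, or_self,
        not_false_eq_true, lab_structureElement_snd π θ 0, lab_structureElement_snd π θ 1,
        lab_structureElement_snd π θ 2, lab_structureElement_snd π θ 3, derivedCochain_zero,
        derivedCochain_two, map_zero, map_add, map_smul, smul_zero, smul_smul, zero_add]
      norm_num [Nat.factorial]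
    · intro k hk hk'
      obtain ⟨m, rfl⟩ : ∃ m, k = m + 1 := ⟨k - 1, by have := Finset.mem_Icc.1 hk; omega⟩
      rw [Prod.smul_snd, lab_structureElement_snd, derivedCochain_of_four_le, map_zero,
        smul_zero, smul_zero]
      simp only [Finset.mem_Icc] at hk hk'
      omega

omit [CharZero 𝕜] in
theorem map_rotate (x y z : g) : π ![x, y, z] = π ![y, z, x] := by
  have := π.map_perm ![x, y, z] (finRotate 3)
  rw [show Equiv.Perm.sign (finRotate 3) = 1 by decide, one_smul] at this
  rw [← this]
  congr 1
  funext j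
  fin_cases j <;> rfl

/-- Multiplication by `s³` turns the Maurer-Cartan equation for `s⁻¹ T` into the modified
Rota-Baxter identity of weight `s²`. -/
theorem derivedCochain_eq_zero_iff {s : 𝕜} (hs : s ≠ 0) (T : g →ₗ[𝕜] g) :
    derivedCochain 𝕜 (s⁻¹ • T) 1 (threeCochain π)
        + (6 : 𝕜)⁻¹ • derivedCochain 𝕜 (s⁻¹ • T) 3 (threeCochain π) = 0 ↔
      IsModifiedRotaBaxter (s ^ 2) π T := by
  have key : ∀ u v w, eval₃ (derivedCochain 𝕜 (s⁻¹ • T) 1 (threeCochain π)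
        + (6 : 𝕜)⁻¹ • derivedCochain 𝕜 (s⁻¹ • T) 3 (threeCochain π)) u v w =
      (s ^ 3)⁻¹ • (π ![T u, T v, T w]
        - (T (π ![T u, T v, w] + π ![T v, T w, u] + π ![T w, T u, v] + s ^ 2 • π ![u, v, w])
          - s ^ 2 • π ![u, v, T w] - s ^ 2 • π ![v, w, T u] - s ^ 2 • π ![w, u, T v])) := by
    intro u v w
    have h : eval₃ (derivedCochain 𝕜 (s⁻¹ • T) 1 (threeCochain π)
        + (6 : 𝕜)⁻¹ • derivedCochain 𝕜 (s⁻¹ • T) 3 (threeCochain π)) u v w =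
      eval₃ (derivedCochain 𝕜 (s⁻¹ • T) 1 (threeCochain π)) u v w
        + (6 : 𝕜)⁻¹ • eval₃ (derivedCochain 𝕜 (s⁻¹ • T) 3 (threeCochain π)) u v w := rfl
    have hπ : ∀ x y z, eval₃ (threeCochain π) x y z = π ![x, y, z] := fun _ _ _ => rfl
    rw [h, eval₃_derivedCochain_one, eval₃_derivedCochain_three]
    simp only [LinearMap.smul_apply, eval₃_smul_fst, eval₃_smul_snd, eval₃_smul_last]
    simp only [hπ, map_add, map_smul]
    -- both sides in terms of `π` with the arguments in the order `u`, `v`, `w`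
    rw [← map_rotate π u (T v) (T w), map_rotate π (T w) (T u) v, ← map_rotate π (T u) v w,
      map_rotate π w u (T v)]
    match_scalars <;> field_simp
  constructor
  · intro h u v w
    have := key u v w
    rw [h] at this
    exact sub_eq_zero.1 ((smul_eq_zero.1 this.symm).resolve_left (inv_ne_zero (pow_ne_zero 3 hs)))
  · intro h
    refine ext_eval₃ fun u v w => ?_
    rw [key, ← h, sub_self, smul_zero]
    rfl

theorem isMaurerCartan_structureElement_iff :
    IsMaurerCartan (degreeZero 𝕜 g) (lab 𝕜 g) (structureElement π θ) ↔
      IsThreeLieBracket π ∧ derivedCochain 𝕜 θ 1 (threeCochain π)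
        + (6 : 𝕜)⁻¹ • derivedCochain 𝕜 θ 3 (threeCochain π) = 0 := by
  have hmem : structureElement π θ ∈ degreeZero 𝕜 g := ⟨⟨_, rfl⟩, ⟨_, rfl⟩⟩
  have hlof : ∀ (n : ℕ) (F : Cochain 𝕜 g g n),
      DirectSum.lof 𝕜 ℕ (fun n => Cochain 𝕜 g g n) n F = 0 ↔ F = 0 := fun n F =>
    map_eq_zero_iff _ (DirectSum.of_injective (β := fun n => Cochain 𝕜 g g n) n)
  rw [← bracket_self_eq_zero_iff (𝕜 := 𝕜), IsMaurerCartan]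
  have hsum : ∀ n, 4 ≤ n → (∑ k ∈ Finset.Icc 1 n, ((k.factorial : 𝕜)⁻¹) •
      lab 𝕜 g k (fun _ => structureElement π θ) = 0 ↔
        bracket 𝕜 g 1 1 (threeCochain π) (threeCochain π) = 0 ∧
          derivedCochain 𝕜 θ 1 (threeCochain π)
            + (6 : 𝕜)⁻¹ • derivedCochain 𝕜 θ 3 (threeCochain π) = 0) := by
    intro n hn
    rw [sum_lab_structureElement π θ hn, Prod.mk_eq_zero, hlof, hlof,
      smul_eq_zero_iff_right (by norm_num)]
  constructor
  · rintro ⟨-, K, hK⟩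
    exact (hsum _ (le_max_right K 4)).1 (hK _ (le_max_left K 4))
  · intro h
    exact ⟨hmem, 4, fun n hn => (hsum n hn).2 h⟩

end MaurerCartan

end

end ThreeLie

theorem mainTheorem2 {𝕜 : Type*} [Field 𝕜] [CharZero 𝕜] {g : Type*} [AddCommGroup g] [Module 𝕜 g]
    (lam s : 𝕜) (hlam : lam ≠ 0) (hs : s ^ 2 = lam)
    (π : g [⋀^Fin 3]→ₗ[𝕜] g) (T : g →ₗ[𝕜] g) :
    (ThreeLie.IsMaurerCartan (ThreeLie.degreeZero 𝕜 g) (ThreeLie.lab 𝕜 g)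
        (ThreeLie.structureElement π (s⁻¹ • T)) ↔
      ThreeLie.IsThreeLieBracket π ∧ ThreeLie.IsModifiedRotaBaxter lam π T) ∧
    Function.Injective (ThreeLie.nuTilde 𝕜 g) ∧
    ∀ (k : ℕ) (α : Fin k → ThreeLie.LSpace 𝕜 g),
      ThreeLie.nuTilde 𝕜 g (ThreeLie.lab 𝕜 g k α) =
        ThreeLie.lmRB 𝕜 g k (fun i => ThreeLie.nuTilde 𝕜 g (α i)) := by
  subst hs
  have hs0 : s ≠ 0 := by
    rintro rfl
    exact hlam (zero_pow two_ne_zero)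
  rw [ThreeLie.isMaurerCartan_structureElement_iff, ThreeLie.derivedCochain_eq_zero_iff π hs0]
  exact ⟨Iff.rfl, ThreeLie.nuTilde_injective, ThreeLie.nuTilde_lab⟩
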